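/- **Corollary ($\Gamma_{\mathcal D}\circ\Gamma_{\mathcal E}$ is an inductive relator for the monad $\mathcal D\circ\mathcal E$, and soundness for the probabilistic calculus with exceptions).** Let $E$ be a set of exceptions. Let $\mathcal D X$ be the set of subdistributions on $X$, with Dirac unit $\delta$, bind $(\mu \mathbin{>\!\!>\!\!=} f)(y)=\sum_x\mu(x)f(x)(y)$ and the pointwise order, and let $\mathcal E X=X+E$. Let $T=\mathcal D\circ\mathcal E$, with $\eta_X(x)=\delta(\mathsf{in}_l(x))$ and $f^\dagger=(f_*)^{\mathcal D}$, where $f_*(\mathsf{in}_l(x))=f(x)$, $f_*(\mathsf{in}_r(e))=\delta(\mathsf{in}_r(e))$ and $(\cdot)^{\mathcal D}$ is Kleisli extension for $\mathcal D$; order $TX$ as $\mathcal D(X+E)$. Let $\Sigma=\{\oplus_p,\mathsf{raise}_e\mid p\in[0,1],\ e\in E\}$ be interpreted on $TX$ by $\mu\oplus_p\nu=p\mu+(1-p)\nu$ and $\mathsf{raise}_e=\delta(\mathsf{in}_r(e))$. For $\mathcal R\subseteq X\times Y$ let - $u\ \Gamma_{\mathcal E}\mathcal R\ v$ iff $u=v=\mathsf{in}_r(e)$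 for some $e$, or $u=\mathsf{in}_l(x)$, $v=\mathsf{in}_l(y)$ with $x\,\mathcal R\,y$; - $\mu\ \Gamma_{\mathcal D}\mathcal R\ \nu$ iff $\mu(U)\le\nu(\mathcal R(U))$ for all $U\subseteq X$; and let $\Gamma=\Gamma_{\mathcal D}\circ\Gamma_{\mathcal E}$. 1. $T$ is a monad (Kleisli triple); with the above order it is an $\omega$CPPO-ordered monad (bind is $\omega$-continuous in both arguments), and the operations of $\Sigma$ are $\omega$-continuous. 2. $\Gamma$ is a relator for the monad $T$: for the functor $T$ one has ${=_{TX}}\subseteq\Gamma(=_X)$; $\Gamma\mathcal S\circ\Gamma\mathcal R\subseteq\Gamma(\mathcal S\circ\mathcal R)$; $\Gamma((f\times g)^{-1}\mathcal R)=(Tf\times Tg)^{-1}\Gamma\mathcal R$; $\mathcal R\subseteq\mathcal S\Rightarrow\Gamma\mathcal R\subseteq\Gamma\mathcal S$; and moreover $x\,\mathcal R\,y\Rightarrow\eta(x)\,\Gamma\mathcal R\,\eta(y)$, and if $x\,\mathcal R\,y$ implies $f(x)\,\Gamma\mathcal S\,g(y)$ for all $x,y$, then $u\,\Gamma\mathcal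 R\,v$ implies $f^\dagger(u)\,\Gamma\mathcal S\,g^\dagger(v)$. 3. $\Gamma$ is inductive ($\bot\,\Gamma\mathcal R\,v$ always; and if $u_n\,\Gamma\mathcal R\,v$ for all members of an $\omega$-chain, then $\bigsqcup_n u_n\,\Gamma\mathcal R\,v$), and it respects every operation of $\Sigma$. 4. (Soundness.) Consider the call-by-value calculus with terms $M,N::=\mathsf{return}\,V\mid VW\mid M\ \mathsf{to}\ x.N\mid\sigma(M_1,\dots,M_k)$ ($\sigma\in\Sigma$) and values $V,W::=x\mid\lambda x.M$. For each closed $M$ the approximations $M^{(n)}\in T\mathcal V_0$ ($\mathcal V_0$ the closed values), given by $M^{(0)}=\bot$, $(\mathsf{return}\,V)^{(n+1)}=\eta(V)$, $((\lambda x.M)V)^{(n+1)}=M[x:=V]^{(n)}$, $(M\ \mathsf{to}\ x.N)^{(n+1)}=M^{(n)}\mathbin{>\!\!>\!\!=}(V\mapsto N[x:=V]^{(n)})$, $\sigma(M_1,\dots)^{(n+1)}=\sigma^T(M_1^{(n)},\dots)$, form an $\omega$-chain, with least upper bound $[\![M]\!]$. An applicative $\Gamma$-simulation is a pair of relations on closed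 terms and closed values such that related terms $M,N$ satisfy $[\![M]\!]\,\Gamma\mathcal R_{\mathcal V}\,[\![N]\!]$ and related values $V,W$ give related terms $VU,WU$ for every closed value $U$. Let $\precsim_\Gamma$ be the largest one, $\simeq_\Gamma\,={\precsim_\Gamma}\cap{\precsim_\Gamma^c}$, and $\sim_\Gamma\,={\precsim_{\Gamma\cap\Gamma^c}}$ (bisimilarity), where $\mathcal R^c$ is the converse and $\Gamma^c\mathcal R=(\Gamma\mathcal R^c)^c$; all are extended to open terms by closing substitutions. Let $\le_\Gamma$ be the union of all compatible (closed under all term and value constructors, including variables) $\lambda$-term relations that are preadequate, i.e. relate closed $M,N$ only if $[\![M]\!]\,\Gamma(\mathcal V_0\times\mathcal V_0)\,[\![N]\!]$, and let $\equiv_\Gamma\,={\le_{\Gamma\cap\Gamma^c}}$. Then $\precsim_\Gamma$ is a precongruence contained in $\le_\Gamma$; $\simeq_\Gamma$ is a congruence contained in $\equiv_\Gamma$; and $\sim_\Gamma\subseteq\equiv_\Gamma$. 5. (Example.) Let $V$ be a closed value and $e\in E$; write $\oplus$ for $\oplus_{1/2}$ and $\mathrm{COMP}(M,N)$ for call-by-value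 composition $M\ \mathsf{to}\ f.\,N\ \mathsf{to}\ g.\,\mathsf{return}\,\lambda y.(g\,y\ \mathsf{to}\ z.\,f\,z)$. Let $W^{\mathsf{raise}}$ and $Z^{\mathsf{raise}}=T\,\underline 1$ be the closed programs, written with self-application and Scott numerals $\underline n$ together with auxiliary programs $T,R$, that implement the recursion $$W^{\mathsf{raise}}\to(V\oplus\mathsf{raise}_e)\oplus\mathrm{COMP}(V,W^{\mathsf{raise}}),\qquad T\,\underline n\to(R\,\underline n\oplus\mathsf{raise}_e)\oplus T\,\underline{n+1},$$ $$R\,\underline 0\to\lambda x.x,\qquad R\,\underline{n+1}\to\mathrm{COMP}(R\,\underline n,V).$$ In each of these rules both sides have the same evaluation, and $W^{\mathsf{raise}}\sim_\Gamma Z^{\mathsf{raise}}$, hence $W^{\mathsf{raise}}\equiv_\Gamma Z^{\mathsf{raise}}$. -/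

import Mathlib

open OmegaCompletePartialOrder
open scoped ENNReal

universe u

noncomputable section

namespace EffCalc

/-! ## Signatures, monads with an order and operations -/

/-- A signature: operation symbols with finite arities. -/
structure Signature : Type (u + 1) where
  Op : Type u
  arity : Op → ℕ

/-- The data of a Kleisli triple on sets, with an ω-complete pointed partial order on each
`obj X` and an interpretation of the operation symbols on each `obj X`. The laws are the
predicates `IsKleisliTriple` and `IsContinuous` below. -/
structure EffectMonad (S : Signature.{u}) : Type (u + 1) where
  obj : Type u → Type u
  unit : ∀ {X : Type u}, X → obj X
  bind : ∀ {X Y : Type u}, obj X → (X → obj Y) → obj Y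
  [order : ∀ X : Type u, OmegaCompletePartialOrder (obj X)]
  [bot : ∀ X : Type u, OrderBot (obj X)]
  interp : ∀ {X : Type u} (o : S.Op), (Fin (S.arity o) → obj X) → obj X

attribute [instance] EffectMonad.order EffectMonad.bot

/-- The functorial action induced by the Kleisli triple. -/
def EffectMonad.map {S : Signature.{u}} (T : EffectMonad S) {X Y : Type u} (f : X → Y)
    (m : T.obj X) : T.obj Y :=
  T.bind m (fun x => T.unit (f x))

/-- The laws of a Kleisli triple. -/
structure IsKleisliTriple {S : Signature.{u}} (T : EffectMonad S) : Prop where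
  unit_bind : ∀ {X Y : Type u} (x : X) (f : X → T.obj Y), T.bind (T.unit x) f = f x
  bind_unit : ∀ {X : Type u} (m : T.obj X), T.bind m T.unit = m
  bind_assoc : ∀ {X Y Z : Type u} (m : T.obj X) (f : X → T.obj Y) (g : Y → T.obj Z),
    T.bind (T.bind m f) g = T.bind m (fun x => T.bind (f x) g)

/-- Bind is continuous in both arguments (functions into `obj Y` carry the pointwise order) and
every operation is continuous: the order is an ωCPPO order on the monad, and the monad carries a
continuous algebra structure for the signature. -/
structure IsContinuous {S : Signature.{u}} (T : EffectMonad S) : Prop where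
  bind_left : ∀ {X Y : Type u} (f : X → T.obj Y), ωScottContinuous (fun m => T.bind m f)
  bind_right : ∀ {X Y : Type u} (m : T.obj X),
    ωScottContinuous (fun f : X → T.obj Y => T.bind m f)
  interp : ∀ {X : Type u} (o : S.Op),
    ωScottContinuous (fun ms : Fin (S.arity o) → T.obj X => T.interp o ms)

/-! ## Relators -/

/-- A map sending each relation between `X` and `Y` to a relation between `F X` and `F Y`. -/
def Lifting (F : Type u → Type u) : Type (u + 1) :=
  ∀ ⦃X Y : Type u⦄, (X → Y → Prop) → F X → F Y → Prop

/-- Composition of liftings: `(G ∘ H) R = G (H R)`. -/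
def Lifting.comp {F K : Type u → Type u} (G : Lifting K) (H : Lifting F) :
    Lifting (fun X => K (F X)) :=
  fun _ _ R => G (H R)

/-- The converse lifting: `Γᶜ R = (Γ (Rᶜ))ᶜ`. -/
def Lifting.conv {F : Type u → Type u} (G : Lifting F) : Lifting F :=
  fun _ _ R a b => G (fun y x => R x y) b a

/-- Pointwise intersection of two liftings. -/
def Lifting.inter {F : Type u → Type u} (G H : Lifting F) : Lifting F :=
  fun _ _ R a b => G R a b ∧ H R a b

/-- `G` is a relator for the functor with object part `F` and arrow part `map`. -/
structure IsRelator (F : Type u → Type u) (map : ∀ {X Y : Type u}, (X → Y) → F X → F Y)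
    (G : Lifting F) : Prop where
  eq_sub : ∀ {X : Type u} (a b : F X), a = b → G (fun x y : X => x = y) a b
  comp_sub : ∀ {X Y Z : Type u} (R : X → Y → Prop) (Q : Y → Z → Prop) (a : F X) (c : F Z),
    (∃ b, G R a b ∧ G Q b c) → G (fun x z => ∃ y, R x y ∧ Q y z) a c
  preimage : ∀ {X Y Z W : Type u} (f : Z → X) (g : W → Y) (R : X → Y → Prop)
    (a : F Z) (b : F W),
    G (fun z w => R (f z) (g w)) a b ↔ G R (map f a) (map g b)
  mono : ∀ {X Y : Type u} (R Q : X → Y → Prop), (∀ x y, R x y → Q x y) →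
    ∀ (a : F X) (b : F Y), G R a b → G Q a b

/-- `G` is a relator (lax extension) for the monad `T`. -/
structure IsMonadRelator {S : Signature.{u}} (T : EffectMonad S) (G : Lifting T.obj) :
    Prop where
  isRelator : IsRelator T.obj T.map G
  lax_unit : ∀ {X Y : Type u} (R : X → Y → Prop) (x : X) (y : Y),
    R x y → G R (T.unit x) (T.unit y)
  lax_bind : ∀ {X X' Y Y' : Type u} (f : X → T.obj X') (g : Y → T.obj Y')
    (R : X → Y → Prop) (Q : X' → Y' → Prop),
    (∀ x y, R x y → G Q (f x) (g y)) →
    ∀ (a : T.obj X) (b : T.obj Y), G R a b → G Q (T.bind a f) (T.bind b g)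

/-- `G` is inductive with respect to the order of `T`. -/
structure IsInductive {S : Signature.{u}} (T : EffectMonad S) (G : Lifting T.obj) : Prop where
  bot_left : ∀ {X Y : Type u} (R : X → Y → Prop) (b : T.obj Y), G R ⊥ b
  sup_left : ∀ {X Y : Type u} (R : X → Y → Prop) (c : Chain (T.obj X)) (b : T.obj Y),
    (∀ n, G R (c n) b) → G R (ωSup c) b

/-- `G` respects the operations of the signature. -/
def RespectsOps {S : Signature.{u}} (T : EffectMonad S) (G : Lifting T.obj) : Prop :=
  ∀ {X Y : Type u} (R : X → Y → Prop) (o : S.Op) (a : Fin (S.arity o) → T.obj X)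
    (b : Fin (S.arity o) → T.obj Y),
    (∀ k, G R (a k) (b k)) → G R (T.interp o a) (T.interp o b)

/-! ## Syntax of the calculus

Terms and values up to renaming of bound variables, as well-scoped de Bruijn terms: `Tm S n` and
`Val S n` have their free variables among `n` variables, and `Tm S 0`, `Val S 0` are closed. -/

mutual
/-- Values: variables and abstractions. -/
inductive Val (S : Signature.{u}) : ℕ → Type u
  | var {n : ℕ} : Fin n → Val S n
  | lam {n : ℕ} : Tm S (n + 1) → Val S n
/-- Terms: `return V`, `V W`, `M to x. N` (with `x` bound in `N`), `σ(M₁, …, Mₖ)`. -/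
inductive Tm (S : Signature.{u}) : ℕ → Type u
  | ret {n : ℕ} : Val S n → Tm S n
  | app {n : ℕ} : Val S n → Val S n → Tm S n
  | seq {n : ℕ} : Tm S n → Tm S (n + 1) → Tm S n
  | op {n : ℕ} : (o : S.Op) → (Fin (S.arity o) → Tm S n) → Tm S n
end

/-- Extension of a renaming under a binder. -/
def liftRen {n m : ℕ} (r : Fin n → Fin m) : Fin (n + 1) → Fin (m + 1) :=
  Fin.cases 0 (fun i => (r i).succ)

mutual
/-- Renaming in values. -/
def Val.rename {S : Signature.{u}} : ∀ {n m : ℕ}, (Fin n → Fin m) → Val S n → Val S m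
  | _, _, r, .var i => .var (r i)
  | _, _, r, .lam M => .lam (Tm.rename (liftRen r) M)
/-- Renaming in terms. -/
def Tm.rename {S : Signature.{u}} : ∀ {n m : ℕ}, (Fin n → Fin m) → Tm S n → Tm S m
  | _, _, r, .ret V => .ret (Val.rename r V)
  | _, _, r, .app V W => .app (Val.rename r V) (Val.rename r W)
  | _, _, r, .seq M N => .seq (Tm.rename r M) (Tm.rename (liftRen r) N)
  | _, _, r, .op o Ms => .op o (fun i => Tm.rename r (Ms i))
end

/-- Extension of a substitution under a binder. -/
def liftSub {S : Signature.{u}} {n m : ℕ} (s : Fin n → Val S m) : Fin (n + 1) → Val S (m + 1) :=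
  Fin.cases (.var 0) (fun i => Val.rename Fin.succ (s i))

mutual
/-- Simultaneous capture-avoiding substitution of values in values. -/
def Val.subst {S : Signature.{u}} : ∀ {n m : ℕ}, (Fin n → Val S m) → Val S n → Val S m
  | _, _, s, .var i => s i
  | _, _, s, .lam M => .lam (Tm.subst (liftSub s) M)
/-- Simultaneous capture-avoiding substitution of values in terms. -/
def Tm.subst {S : Signature.{u}} : ∀ {n m : ℕ}, (Fin n → Val S m) → Tm S n → Tm S m
  | _, _, s, .ret V => .ret (Val.subst s V)
  | _, _, s, .app V W => .app (Val.subst s V) (Val.subst s W)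
  | _, _, s, .seq M N => .seq (Tm.subst s M) (Tm.subst (liftSub s) N)
  | _, _, s, .op o Ms => .op o (fun i => Tm.subst s (Ms i))
end

/-- `M[x := V]` for a term `M` with at most one free variable and a closed value `V`. -/
def Tm.inst {S : Signature.{u}} (M : Tm S 1) (V : Val S 0) : Tm S 0 :=
  Tm.subst (fun _ => V) M

/-! ## Operational semantics -/

/-- The `n`-th approximation of the evaluation of a closed term. -/
def approx {S : Signature.{u}} (T : EffectMonad S) : ℕ → Tm S 0 → T.obj (Val S 0)
  | 0, _ => ⊥
  | _ + 1, .ret V => T.unit V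
  | _ + 1, .app (.var i) _ => i.elim0
  | n + 1, .app (.lam M) V => approx T n (M.inst V)
  | n + 1, .seq M N => T.bind (approx T n M) (fun V => approx T n (N.inst V))
  | n + 1, .op o Ms => T.interp o (fun i => approx T n (Ms i))

open Classical in
/-- The evaluation of a closed term: the least upper bound of its approximations. (They form a
chain as soon as bind and the operations are monotone; otherwise the value is irrelevant.) -/
def eval {S : Signature.{u}} (T : EffectMonad S) (M : Tm S 0) : T.obj (Val S 0) :=
  if h : Monotone (fun n => approx T n M) then ωSup ⟨fun n => approx T n M, h⟩ else ⊥

/-! ## Relations on terms, applicative similarity, contextual preorder -/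

/-- A closed relation: a relation on closed terms and a relation on closed values. -/
structure ClosedRel (S : Signature.{u}) where
  tm : Tm S 0 → Tm S 0 → Prop
  val : Val S 0 → Val S 0 → Prop

/-- A λ-term relation: for each context, relations on the terms and values in that context. -/
structure TermRel (S : Signature.{u}) where
  tm : ∀ n : ℕ, Tm S n → Tm S n → Prop
  val : ∀ n : ℕ, Val S n → Val S n → Prop

/-- Inclusion of λ-term relations. -/
def TermRel.Sub {S : Signature.{u}} (R Q : TermRel S) : Prop :=
  (∀ n M N, R.tm n M N → Q.tm n M N) ∧ (∀ n V W, R.val n V W → Q.val n V W)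

/-- Open extension of a closed relation. -/
def ClosedRel.openExt {S : Signature.{u}} (R : ClosedRel S) : TermRel S where
  tm n M N := ∀ s : Fin n → Val S 0, R.tm (M.subst s) (N.subst s)
  val n V W := ∀ s : Fin n → Val S 0, R.val (V.subst s) (W.subst s)

/-- Compatibility: closure under all the constructors of the calculus. -/
structure TermRel.IsCompatible {S : Signature.{u}} (R : TermRel S) : Prop where
  var : ∀ n (i : Fin n), R.val n (.var i) (.var i)
  lam : ∀ n M N, R.tm (n + 1) M N → R.val n (.lam M) (.lam N)
  ret : ∀ n V W, R.val n V W → R.tm n (.ret V) (.ret W)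
  app : ∀ n V V' W W', R.val n V V' → R.val n W W' → R.tm n (.app V W) (.app V' W')
  seq : ∀ n M M' N N', R.tm n M M' → R.tm (n + 1) N N' → R.tm n (.seq M N) (.seq M' N')
  op : ∀ n (o : S.Op) (Ms Ns : Fin (S.arity o) → Tm S n),
    (∀ i, R.tm n (Ms i) (Ns i)) → R.tm n (.op o Ms) (.op o Ns)

/-- A precongruence is a compatible preorder. -/
structure TermRel.IsPrecongruence {S : Signature.{u}} (R : TermRel S) : Prop where
  compatible : R.IsCompatible
  refl_tm : ∀ n M, R.tm n M M
  refl_val : ∀ n V, R.val n V V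
  trans_tm : ∀ n L M N, R.tm n L M → R.tm n M N → R.tm n L N
  trans_val : ∀ n U V W, R.val n U V → R.val n V W → R.val n U W

/-- A congruence is a compatible equivalence. -/
structure TermRel.IsCongruence {S : Signature.{u}} (R : TermRel S) : Prop where
  precongruence : R.IsPrecongruence
  symm_tm : ∀ n M N, R.tm n M N → R.tm n N M
  symm_val : ∀ n V W, R.val n V W → R.val n W V

/-- Preadequacy: related closed programs have evaluations related by `G` applied to the trivial
relation on closed values. -/
def TermRel.IsPreadequate {S : Signature.{u}} (T : EffectMonad S) (G : Lifting T.obj)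
    (R : TermRel S) : Prop :=
  ∀ M N : Tm S 0, R.tm 0 M N → G (fun _ _ : Val S 0 => True) (eval T M) (eval T N)

/-- The contextual preorder: the union of all compatible and preadequate λ-term relations. -/
def ctxPreorder {S : Signature.{u}} (T : EffectMonad S) (G : Lifting T.obj) : TermRel S where
  tm n M N := ∃ R : TermRel S, R.IsCompatible ∧ R.IsPreadequate T G ∧ R.tm n M N
  val n V W := ∃ R : TermRel S, R.IsCompatible ∧ R.IsPreadequate T G ∧ R.val n V W

/-- Contextual equivalence. -/
def ctxEquiv {S : Signature.{u}} (T : EffectMonad S) (G : Lifting T.obj) : TermRel S :=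
  ctxPreorder T (G.inter G.conv)

/-- Applicative simulations. -/
structure IsSimulation {S : Signature.{u}} (T : EffectMonad S) (G : Lifting T.obj)
    (R : ClosedRel S) : Prop where
  tm : ∀ M N, R.tm M N → G R.val (eval T M) (eval T N)
  val : ∀ V W, R.val V W → ∀ U : Val S 0, R.tm (.app V U) (.app W U)

/-- Applicative similarity: the union of all applicative simulations. -/
def similarity {S : Signature.{u}} (T : EffectMonad S) (G : Lifting T.obj) : ClosedRel S where
  tm M N := ∃ R : ClosedRel S, IsSimulation T G R ∧ R.tm M N
  val V W := ∃ R : ClosedRel S, IsSimulation T G R ∧ R.val V W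

/-- Two-way similarity: the intersection of similarity with its converse. -/
def twoWaySimilarity {S : Signature.{u}} (T : EffectMonad S) (G : Lifting T.obj) :
    ClosedRel S where
  tm M N := (similarity T G).tm M N ∧ (similarity T G).tm N M
  val V W := (similarity T G).val V W ∧ (similarity T G).val W V

/-- Applicative bisimilarity. -/
def bisimilarity {S : Signature.{u}} (T : EffectMonad S) (G : Lifting T.obj) : ClosedRel S :=
  similarity T (G.inter G.conv)

/-! ## Subdistributions -/

/-- Subdistributions on `X`: the bound on the total mass forces values in `[0, 1]` and a countable
support. -/
def Subdist (X : Type u) : Type u :=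
  {m : X → ℝ≥0∞ // ∑' x, m x ≤ 1}

instance (X : Type u) : CoeFun (Subdist X) (fun _ => X → ℝ≥0∞) := ⟨Subtype.val⟩

instance (X : Type u) : PartialOrder (Subdist X) :=
  inferInstanceAs (PartialOrder {m : X → ℝ≥0∞ // ∑' x, m x ≤ 1})

instance (X : Type u) : OrderBot (Subdist X) where
  bot := ⟨fun _ => 0, by simp⟩
  bot_le m := fun x => zero_le (a := m.1 x)

instance (X : Type u) : OmegaCompletePartialOrder (Subdist X) where
  ωSup c := ⟨fun x => ⨆ n, (c n).1 x, by
    rw [ENNReal.tsum_eq_iSup_sum]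
    refine iSup_le fun s => ?_
    rw [ENNReal.finsetSum_iSup_of_monotone (f := fun x n => (c n).1 x)
      (fun x i j hij => c.monotone hij x)]
    exact iSup_le fun n => (ENNReal.sum_le_tsum s).trans (c n).2⟩
  le_ωSup c i := fun x => le_iSup (fun n => (c n).1 x) i
  ωSup_le c m h := fun x => iSup_le fun n => h n x

/-- The mass `μ(U)` of a set. -/
def Subdist.mass {X : Type u} (m : Subdist X) (U : Set X) : ℝ≥0∞ :=
  ∑' x : U, m x

open Classical in
/-- The Dirac distribution. -/
def Subdist.dirac {X : Type u} (x : X) : Subdist X :=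
  ⟨fun y => if y = x then 1 else 0, by simp⟩

/-- Bind of the subdistribution monad: `(μ >>= f)(y) = ∑ₓ μ(x) · f(x)(y)`. -/
def Subdist.bind {X Y : Type u} (m : Subdist X) (f : X → Subdist Y) : Subdist Y :=
  ⟨fun y => ∑' x, m x * f x y, by
    rw [ENNReal.tsum_comm]
    calc ∑' x, ∑' y, m x * f x y = ∑' x, m x * ∑' y, f x y := by
          simp_rw [ENNReal.tsum_mul_left]
      _ ≤ ∑' x, m x :=
          ENNReal.tsum_le_tsum fun x => mul_le_of_le_one_right (zero_le) (f x).2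
      _ ≤ 1 := m.2⟩

/-- Probabilistic choice: `p · μ + (1 - p) · ν`. -/
def Subdist.mix {X : Type u} (p : unitInterval) (m k : Subdist X) : Subdist X :=
  ⟨fun x => ENNReal.ofReal (p : ℝ) * m x + ENNReal.ofReal (1 - (p : ℝ)) * k x, by
    rw [ENNReal.tsum_add, ENNReal.tsum_mul_left, ENNReal.tsum_mul_left]
    calc ENNReal.ofReal (p : ℝ) * ∑' x, m x + ENNReal.ofReal (1 - (p : ℝ)) * ∑' x, k x
        ≤ ENNReal.ofReal (p : ℝ) * 1 + ENNReal.ofReal (1 - (p : ℝ)) * 1 := by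
          gcongr
          · exact m.2
          · exact k.2
      _ = 1 := by
          rw [mul_one, mul_one, ← ENNReal.ofReal_add p.2.1 (sub_nonneg.2 p.2.2)]
          simp⟩

/-- The simulation relator for subdistributions. -/
def subdistRelator : Lifting Subdist.{u} :=
  fun X _ R m k => ∀ U : Set X, m.mass U ≤ k.mass {y | ∃ x ∈ U, R x y}

/-! ## The probabilistic calculus with exceptions -/

/-- The simulation relator for the exception monad `X ↦ X ⊕ E`: equal exceptions are related,
and values are related when they are related by `R`. -/
def excRelator (E : Type u) : Lifting (fun X : Type u => X ⊕ E) :=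
  fun _ _ R => Sum.LiftRel R (fun e e' : E => e = e')

/-- Operation symbols: probabilistic choices `⊕ₚ` for `p ∈ [0, 1]` and `raiseₑ` for `e ∈ E`. -/
inductive ProbExcOp (E : Type u) : Type u
  | choice (p : unitInterval) : ProbExcOp E
  | raise (e : E) : ProbExcOp E

/-- The signature of the probabilistic calculus with exceptions. -/
def probExcSig (E : Type u) : Signature.{u} where
  Op := ProbExcOp E
  arity
    | .choice _ => 2
    | .raise _ => 0

/-- The composite of the subdistribution monad and the exception monad, with the order of the
subdistribution monad and the operations `⊕ₚ` and `raiseₑ`. -/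
def probExcMonad (E : Type u) : EffectMonad (probExcSig E) where
  obj X := Subdist (X ⊕ E)
  unit x := Subdist.dirac (Sum.inl x)
  bind m f := m.bind (Sum.elim f (fun e => Subdist.dirac (Sum.inr e)))
  interp
    | .choice p, ms => Subdist.mix p (ms (0 : Fin 2)) (ms (1 : Fin 2))
    | .raise e, _ => Subdist.dirac (Sum.inr e)

/-- The composite of the subdistribution relator and the exception relator. -/
def probExcRelator (E : Type u) : Lifting (probExcMonad E).obj :=
  Lifting.comp (K := Subdist) (F := fun X => X ⊕ E) subdistRelator (excRelator E)

/-- Weakening of a closed value to an arbitrary context. -/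
def Val.weaken {S : Signature.{u}} {n : ℕ} (V : Val S 0) : Val S n :=
  Val.rename Fin.elim0 V

/-- Weakening of a closed term to an arbitrary context. -/
def Tm.weaken {S : Signature.{u}} {n : ℕ} (M : Tm S 0) : Tm S n :=
  Tm.rename Fin.elim0 M

variable {E : Type u} {n : ℕ}

/-- Fair probabilistic choice. -/
def fair (M N : Tm (probExcSig E) n) : Tm (probExcSig E) n :=
  .op (S := probExcSig E) (.choice ⟨1 / 2, by norm_num, by norm_num⟩)
    (fun i : Fin 2 => if i = 0 then M else N)

/-- `raiseₑ`. -/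
def raise (e : E) : Tm (probExcSig E) n :=
  .op (S := probExcSig E) (.raise e) (fun i : Fin 0 => i.elim0)

/-- Call-by-value composition of functions, `M to f. N to g. return (λ y. (g y to z. f z))`. -/
def compose (M N : Tm (probExcSig E) n) : Tm (probExcSig E) n :=
  .seq M (.seq (N.rename Fin.succ)
    (.ret (.lam (.seq (.app (.var 1) (.var 0)) (.app (.var 3) (.var 0))))))

/-- The identity function `λ x. return x`. -/
def identity : Val (probExcSig E) n :=
  .lam (.ret (.var 0))

/-- Successor of a Scott numeral: `λ z. return (λ s. s V)`. -/
def succNum (V : Val (probExcSig E) n) : Val (probExcSig E) n :=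
  .lam (.ret (.lam (.app (.var 0) ((V.rename Fin.succ).rename Fin.succ))))

/-- Scott numerals; `0` is `λ z. return (λ s. z s)`. -/
def num : ℕ → Val (probExcSig E) n
  | 0 => .lam (.ret (.lam (.app (.var 1) (.var 0))))
  | k + 1 => succNum (num k)

/-- `ρ = λ r. return (λ k. case k of 0 ↦ return (λ x. x) | m + 1 ↦ COMP(r r m, V))`. -/
def compRec (V : Val (probExcSig E) 0) : Val (probExcSig E) 0 :=
  .lam (.ret (.lam
    (.seq (.app (.var 0) (.lam (.ret identity)))
      (.app (.var 0) (.lam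
        (compose (.seq (.app (.var 3) (.var 3)) (.app (.var 0) (.var 1)))
          (.ret V.weaken)))))))

/-- The program `R` applied to an argument: `(ρ ρ) k`. -/
def progR (V : Val (probExcSig E) 0) (k : Val (probExcSig E) n) : Tm (probExcSig E) n :=
  .seq (.app (compRec V).weaken (compRec V).weaken) (.app (.var 0) (k.rename Fin.succ))

/-- `τ = λ t. return (λ k. ((R k) ⊕ raiseₑ) ⊕ (t t (k + 1)))`. -/
def sumRec (V : Val (probExcSig E) 0) (e : E) : Val (probExcSig E) 0 :=
  .lam (.ret (.lam
    (fair (fair (progR V (.var 0)) (raise e))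
      (.seq (.app (.var 1) (.var 1)) (.app (.var 0) (succNum (.var 1)))))))

/-- The program `T` applied to an argument: `(τ τ) k`. -/
def progT (V : Val (probExcSig E) 0) (e : E) (k : Val (probExcSig E) n) : Tm (probExcSig E) n :=
  .seq (.app (sumRec V e).weaken (sumRec V e).weaken) (.app (.var 0) (k.rename Fin.succ))

/-- `Z = T 1`. -/
def progZ (V : Val (probExcSig E) 0) (e : E) : Tm (probExcSig E) 0 :=
  progT V e (num 1)

/-- `λ w. (V ⊕ raiseₑ) ⊕ COMP(V, w w)`. -/
def wRec (V : Val (probExcSig E) 0) (e : E) : Val (probExcSig E) 0 :=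
  .lam (fair (fair (.ret V.weaken) (raise e)) (compose (.ret V.weaken) (.app (.var 0) (.var 0))))

/-- The program `W`, recursively `W → (V ⊕ raiseₑ) ⊕ COMP(V, W)`. -/
def progW (V : Val (probExcSig E) 0) (e : E) : Tm (probExcSig E) 0 :=
  .app (wRec V e) (wRec V e)

end EffCalc

end

open EffCalc

namespace EffCalc

/-! ## Substitution -/

section Substitution

variable {S : Signature.{u}}

-- Soundness does not depend on probabilities or exceptions. It holds for every continuous Kleisli
-- triple with an inductive monad relator that respects the operations, by Howe's method. The Howe
-- closure of open similarity contains similarity, is compatible by construction, and is closed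
-- under substituting related values for variables. It is also a simulation. `HoweTm.approx` proves
-- by induction on the stage that each finite approximation of the left term is related to the full
-- evaluation of the right term: the lax unit and bind laws treat `ret` and `seq`, respect for
-- operations treats `op`, and substitutivity treats beta reduction. Inductiveness then passes to
-- the least upper bound on the left. Hence the closure coincides with similarity, which is
-- therefore compatible.
--
-- Bisimilarity is not treated by Howe's method directly, since the symmetrised lifting need not be
-- inductive. It is contained in two-way similarity, the intersection of a precongruence with its
-- converse. This is a congruence and is preadequate in both directions.
--
-- For the concrete relator the substantial point is the bind law. It reduces to comparing
-- expectations of two functions with values in `[0, 1]`, knowing only inequalities between masses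
-- of sets. `subdistRelator.expect_le` does this by the layer cake formula, comparing superlevel
-- sets, so no couplings are needed.
--
-- In the example both programs unfold to a system `a j = ½ c j + ½ a (j + 1)`, where `c j` is a
-- fair choice between a power of `V` and the exception. The powers are nested to the left for `W`
-- and to the right for `Z`, so they differ as terms, but associativity of bind makes them agree on
-- every argument. After pushing forward along `applyVal` both systems have the same coefficients,
-- and such a system has only one solution (`Subdist.eq_of_mix_oneHalf`). The preimage law of the
-- relator turns equality of the pushforwards into bisimilarity.

@[simp] theorem liftRen_zero {n m : ℕ} (r : Fin n → Fin m) : liftRen r 0 = 0 := rfl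

@[simp] theorem liftRen_succ {n m : ℕ} (r : Fin n → Fin m) (i : Fin n) :
    liftRen r i.succ = (r i).succ := rfl

@[simp] theorem liftSub_zero {n m : ℕ} (s : Fin n → Val S m) : liftSub s 0 = .var 0 := rfl

@[simp] theorem liftSub_succ {n m : ℕ} (s : Fin n → Val S m) (i : Fin n) :
    liftSub s i.succ = (s i).rename Fin.succ := rfl

theorem liftRen_comp {n m k : ℕ} (r : Fin n → Fin m) (q : Fin m → Fin k) :
    (fun i => liftRen q (liftRen r i)) = liftRen (fun i => q (r i)) := by
  funext i
  cases i using Fin.cases <;> rfl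

theorem liftSub_liftRen {n m k : ℕ} (r : Fin n → Fin m) (s : Fin m → Val S k) :
    (fun i => liftSub s (liftRen r i)) = liftSub (fun i => s (r i)) := by
  funext i
  cases i using Fin.cases <;> rfl

-- The fusion laws for renaming and substitution are ordered by what is needed under a binder. Since
-- `liftSub` renames the substituted values, moving a renaming past it needs fusion of two
-- renamings, and composing two lifted substitutions needs both mixed laws.
mutual
theorem Val.rename_rename : ∀ {n m k : ℕ} (r : Fin n → Fin m) (q : Fin m → Fin k) (V : Val S n),
    (V.rename r).rename q = V.rename (fun i => q (r i))
  | _, _, _, r, q, .var i => by simp only [Val.rename]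
  | _, _, _, r, q, .lam M => by
      simp only [Val.rename]
      rw [Tm.rename_rename, liftRen_comp]
theorem Tm.rename_rename : ∀ {n m k : ℕ} (r : Fin n → Fin m) (q : Fin m → Fin k) (M : Tm S n),
    (M.rename r).rename q = M.rename (fun i => q (r i))
  | _, _, _, r, q, .ret V => by simp only [Tm.rename]; rw [Val.rename_rename]
  | _, _, _, r, q, .app V W => by
      simp only [Tm.rename]
      rw [Val.rename_rename, Val.rename_rename]
  | _, _, _, r, q, .seq M N => by
      simp only [Tm.rename]
      rw [Tm.rename_rename, Tm.rename_rename, liftRen_comp]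
  | _, _, _, r, q, .op o Ms => by
      simp only [Tm.rename]
      congr 1
      funext i
      rw [Tm.rename_rename]
end

mutual
theorem Val.subst_rename : ∀ {n m k : ℕ} (r : Fin n → Fin m) (s : Fin m → Val S k) (V : Val S n),
    (V.rename r).subst s = V.subst (fun i => s (r i))
  | _, _, _, r, s, .var i => by simp only [Val.rename, Val.subst]
  | _, _, _, r, s, .lam M => by
      simp only [Val.rename, Val.subst]
      rw [Tm.subst_rename, liftSub_liftRen]
theorem Tm.subst_rename : ∀ {n m k : ℕ} (r : Fin n → Fin m) (s : Fin m → Val S k) (M : Tm S n),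
    (M.rename r).subst s = M.subst (fun i => s (r i))
  | _, _, _, r, s, .ret V => by simp only [Tm.rename, Tm.subst]; rw [Val.subst_rename]
  | _, _, _, r, s, .app V W => by
      simp only [Tm.rename, Tm.subst]
      rw [Val.subst_rename, Val.subst_rename]
  | _, _, _, r, s, .seq M N => by
      simp only [Tm.rename, Tm.subst]
      rw [Tm.subst_rename, Tm.subst_rename, liftSub_liftRen]
  | _, _, _, r, s, .op o Ms => by
      simp only [Tm.rename, Tm.subst]
      congr 1
      funext i
      rw [Tm.subst_rename]
end

theorem rename_liftSub {n m k : ℕ} (s : Fin n → Val S m) (r : Fin m → Fin k) :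
    (fun i => (liftSub s i).rename (liftRen r)) = liftSub (fun i => (s i).rename r) := by
  funext i
  cases i using Fin.cases with
  | zero => simp [Val.rename]
  | succ i => simp [Val.rename_rename]

mutual
theorem Val.rename_subst : ∀ {n m k : ℕ} (s : Fin n → Val S m) (r : Fin m → Fin k) (V : Val S n),
    (V.subst s).rename r = V.subst (fun i => (s i).rename r)
  | _, _, _, s, r, .var i => by simp only [Val.subst]
  | _, _, _, s, r, .lam M => by
      simp only [Val.rename, Val.subst]
      rw [Tm.rename_subst, rename_liftSub]
theorem Tm.rename_subst : ∀ {n m k : ℕ} (s : Fin n → Val S m) (r : Fin m → Fin k) (M : Tm S n),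
    (M.subst s).rename r = M.subst (fun i => (s i).rename r)
  | _, _, _, s, r, .ret V => by simp only [Tm.rename, Tm.subst]; rw [Val.rename_subst]
  | _, _, _, s, r, .app V W => by
      simp only [Tm.rename, Tm.subst]
      rw [Val.rename_subst, Val.rename_subst]
  | _, _, _, s, r, .seq M N => by
      simp only [Tm.rename, Tm.subst]
      rw [Tm.rename_subst, Tm.rename_subst, rename_liftSub]
  | _, _, _, s, r, .op o Ms => by
      simp only [Tm.rename, Tm.subst]
      congr 1
      funext i
      rw [Tm.rename_subst]
end

theorem subst_liftSub {n m k : ℕ} (s : Fin n → Val S m) (t : Fin m → Val S k) :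
    (fun i => (liftSub s i).subst (liftSub t)) = liftSub (fun i => (s i).subst t) := by
  funext i
  cases i using Fin.cases with
  | zero => simp [Val.subst]
  | succ i => simp [Val.subst_rename, Val.rename_subst]

mutual
theorem Val.subst_subst : ∀ {n m k : ℕ} (s : Fin n → Val S m) (t : Fin m → Val S k) (V : Val S n),
    (V.subst s).subst t = V.subst (fun i => (s i).subst t)
  | _, _, _, s, t, .var i => by simp only [Val.subst]
  | _, _, _, s, t, .lam M => by
      simp only [Val.subst]
      rw [Tm.subst_subst, subst_liftSub]
theorem Tm.subst_subst : ∀ {n m k : ℕ} (s : Fin n → Val S m) (t : Fin m → Val S k) (M : Tm S n),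
    (M.subst s).subst t = M.subst (fun i => (s i).subst t)
  | _, _, _, s, t, .ret V => by simp only [Tm.subst]; rw [Val.subst_subst]
  | _, _, _, s, t, .app V W => by
      simp only [Tm.subst]
      rw [Val.subst_subst, Val.subst_subst]
  | _, _, _, s, t, .seq M N => by
      simp only [Tm.subst]
      rw [Tm.subst_subst, Tm.subst_subst, subst_liftSub]
  | _, _, _, s, t, .op o Ms => by
      simp only [Tm.subst]
      congr 1
      funext i
      rw [Tm.subst_subst]
end

theorem liftSub_var {n m : ℕ} (r : Fin n → Fin m) :
    liftSub (fun i => (.var (r i) : Val S m)) = fun i => .var (liftRen r i) := by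
  funext i
  cases i using Fin.cases <;> simp [Val.rename]

mutual
theorem Val.subst_var : ∀ {n m : ℕ} (r : Fin n → Fin m) (V : Val S n),
    V.subst (fun i => .var (r i)) = V.rename r
  | _, _, r, .var i => by simp only [Val.subst, Val.rename]
  | _, _, r, .lam M => by
      simp only [Val.subst, Val.rename]
      rw [liftSub_var, Tm.subst_var]
theorem Tm.subst_var : ∀ {n m : ℕ} (r : Fin n → Fin m) (M : Tm S n),
    M.subst (fun i => .var (r i)) = M.rename r
  | _, _, r, .ret V => by simp only [Tm.subst, Tm.rename]; rw [Val.subst_var]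
  | _, _, r, .app V W => by
      simp only [Tm.subst, Tm.rename]
      rw [Val.subst_var, Val.subst_var]
  | _, _, r, .seq M N => by
      simp only [Tm.subst, Tm.rename]
      rw [Tm.subst_var, liftSub_var, Tm.subst_var]
  | _, _, r, .op o Ms => by
      simp only [Tm.subst, Tm.rename]
      congr 1
      funext i
      rw [Tm.subst_var]
end

theorem liftRen_id {n : ℕ} : liftRen (fun i : Fin n => i) = fun i => i := by
  funext i
  cases i using Fin.cases <;> simp

mutual
theorem Val.rename_id : ∀ {n : ℕ} (V : Val S n), V.rename (fun i => i) = V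
  | _, .var i => by simp only [Val.rename]
  | _, .lam M => by simp only [Val.rename]; rw [liftRen_id, Tm.rename_id]
theorem Tm.rename_id : ∀ {n : ℕ} (M : Tm S n), M.rename (fun i => i) = M
  | _, .ret V => by simp only [Tm.rename]; rw [Val.rename_id]
  | _, .app V W => by simp only [Tm.rename]; rw [Val.rename_id, Val.rename_id]
  | _, .seq M N => by simp only [Tm.rename]; rw [Tm.rename_id, liftRen_id, Tm.rename_id]
  | _, .op o Ms => by
      simp only [Tm.rename]
      congr 1
      funext i
      rw [Tm.rename_id]
end

@[simp] theorem Val.subst_closed (V : Val S 0) (s : Fin 0 → Val S 0) : V.subst s = V := by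
  rw [show s = fun i => .var i from funext fun i => i.elim0, Val.subst_var, Val.rename_id]

@[simp] theorem Tm.subst_closed (M : Tm S 0) (s : Fin 0 → Val S 0) : M.subst s = M := by
  rw [show s = fun i => .var i from funext fun i => i.elim0, Tm.subst_var, Tm.rename_id]

end Substitution

end EffCalc

namespace EffCalc

/-! ## Evaluation -/

section Evaluation

variable {S : Signature.{u}} {T : EffectMonad S}

theorem IsContinuous.bind_mono (h : IsContinuous T) {X Y : Type u} {m m' : T.obj X}
    {f f' : X → T.obj Y} (hm : m ≤ m') (hf : f ≤ f') : T.bind m f ≤ T.bind m' f' :=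
  ((h.bind_left f).monotone hm).trans ((h.bind_right m').monotone hf)

theorem approx_le_succ (h : IsContinuous T) : ∀ (n : ℕ) (M : Tm S 0),
    approx T n M ≤ approx T (n + 1) M
  | 0, M => by rw [approx]; exact bot_le
  | n + 1, .ret V => by simp only [approx]; exact le_rfl
  | n + 1, .app (.var i) _ => i.elim0
  | n + 1, .app (.lam M) V => by
      rw [approx, approx]
      exact approx_le_succ h n _
  | n + 1, .seq M N => by
      rw [approx, approx]
      exact h.bind_mono (approx_le_succ h n M) fun V => approx_le_succ h n _
  | n + 1, .op o Ms => by
      rw [approx, approx]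
      exact (h.interp o).monotone fun i => approx_le_succ h n _

theorem approx_monotone (h : IsContinuous T) (M : Tm S 0) : Monotone fun n => approx T n M :=
  monotone_nat_of_le_succ fun n => approx_le_succ h n M

/-- The chain of approximations of a closed term. -/
def approxChain (h : IsContinuous T) (M : Tm S 0) : Chain (T.obj (Val S 0)) :=
  ⟨fun n => approx T n M, approx_monotone h M⟩

theorem eval_eq_ωSup (h : IsContinuous T) (M : Tm S 0) : eval T M = ωSup (approxChain h M) :=
  dif_pos (approx_monotone h M)

theorem isLUB_eval (h : IsContinuous T) (M : Tm S 0) :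
    IsLUB (Set.range fun n => approx T n M) (eval T M) := by
  rw [eval_eq_ωSup h]
  exact isLUB_range_ωSup (approxChain h M)

theorem approx_le_eval (h : IsContinuous T) (n : ℕ) (M : Tm S 0) : approx T n M ≤ eval T M :=
  (isLUB_eval h M).1 ⟨n, rfl⟩

/-- Stage `0` is `⊥` whatever the term, so only the positive stages, where `approx` unfolds along
the term, need to be bounded. -/
theorem eval_le (h : IsContinuous T) {M : Tm S 0} {m : T.obj (Val S 0)}
    (hm : ∀ n, approx T (n + 1) M ≤ m) : eval T M ≤ m := by
  refine (isLUB_eval h M).2 ?_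
  rintro _ ⟨n, rfl⟩
  exact (approx_le_succ h n M).trans (hm n)

theorem eval_ret (h : IsContinuous T) (V : Val S 0) : eval T (.ret V) = T.unit V := by
  refine le_antisymm (eval_le h fun n => ?_) ?_
  · rw [approx]
  · have := approx_le_eval h 1 (.ret V)
    rwa [approx] at this

theorem eval_app (h : IsContinuous T) (M : Tm S 1) (V : Val S 0) :
    eval T (.app (.lam M) V) = eval T (M.inst V) := by
  refine le_antisymm (eval_le h fun n => ?_) ?_
  · rw [approx]
    exact approx_le_eval h n _
  · refine (isLUB_eval h _).2 ?_
    rintro _ ⟨n, rfl⟩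
    have := approx_le_eval h (n + 1) (.app (.lam M) V)
    rwa [approx] at this

theorem eval_seq (h : IsContinuous T) (M : Tm S 0) (N : Tm S 1) :
    eval T (.seq M N) = T.bind (eval T M) fun V => eval T (N.inst V) := by
  refine le_antisymm (eval_le h fun n => ?_) ?_
  · rw [approx]
    exact h.bind_mono (approx_le_eval h n M) fun V => approx_le_eval h n _
  · let d : Chain (Val S 0 → T.obj (Val S 0)) :=
      ⟨fun n V => approx T n (N.inst V), fun i j hij V => approx_monotone h _ hij⟩
    have hd : (fun V => eval T (N.inst V)) = ωSup d := by
      funext V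
      exact eval_eq_ωSup h _
    rw [hd, eval_eq_ωSup h, (h.bind_left _).map_ωSup]
    refine ωSup_le _ _ fun i => ?_
    change T.bind (approx T i M) (ωSup d) ≤ _
    rw [(h.bind_right _).map_ωSup]
    refine ωSup_le _ _ fun j => ?_
    -- Continuity in each argument separately yields two independent stages; both lie below their
    -- maximum, and one more stage evaluates the `seq`.
    have := approx_le_eval h (max i j + 1) (.seq M N)
    rw [approx] at this
    exact (h.bind_mono (approx_monotone h M (le_max_left i j))
      fun V => approx_monotone h (N.inst V) (le_max_right i j)).trans this

theorem eval_op (h : IsContinuous T) (o : S.Op) (Ms : Fin (S.arity o) → Tm S 0) :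
    eval T (.op o Ms) = T.interp o fun i => eval T (Ms i) := by
  refine le_antisymm (eval_le h fun n => ?_) ?_
  · rw [approx]
    exact (h.interp o).monotone fun i => approx_le_eval h n _
  · let d : Chain (Fin (S.arity o) → T.obj (Val S 0)) :=
      ⟨fun n i => approx T n (Ms i), fun i j hij k => approx_monotone h _ hij⟩
    have hd : (fun i => eval T (Ms i)) = ωSup d := by
      funext i
      exact eval_eq_ωSup h _
    rw [hd, (h.interp o).map_ωSup]
    refine ωSup_le _ _ fun j => ?_
    have := approx_le_eval h (j + 1) (.op o Ms)
    rwa [approx] at this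

end Evaluation

/-! ## Applicative similarity -/

section Similarity

variable {S : Signature.{u}} {T : EffectMonad S} {G : Lifting T.obj}

theorem IsRelator.refl {F : Type u → Type u} {map : ∀ {X Y : Type u}, (X → Y) → F X → F Y}
    {G : Lifting F} (hG : IsRelator F map G) {X : Type u} {R : X → X → Prop} (hR : ∀ x, R x x)
    (a : F X) : G R a a :=
  hG.mono (fun x y => x = y) R (fun x _ h => h ▸ hR x) a a (hG.eq_sub a a rfl)

theorem IsRelator.trans {F : Type u → Type u} {map : ∀ {X Y : Type u}, (X → Y) → F X → F Y}
    {G : Lifting F} (hG : IsRelator F map G) {X Y Z : Type u} {R : X → Y → Prop}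
    {Q : Y → Z → Prop} {P : X → Z → Prop} (h : ∀ x y z, R x y → Q y z → P x z) {a : F X} {b : F Y}
    {c : F Z} (hab : G R a b) (hbc : G Q b c) : G P a c :=
  hG.mono _ P (fun x z ⟨y, h₁, h₂⟩ => h x y z h₁ h₂) a c (hG.comp_sub R Q a c ⟨b, hab, hbc⟩)

theorem similarity_isSimulation (hG : IsRelator T.obj T.map G) :
    IsSimulation T G (similarity T G) where
  tm M N := fun ⟨R, hR, h⟩ =>
    hG.mono R.val _ (fun _ _ hV => ⟨R, hR, hV⟩) _ _ (hR.tm M N h)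
  val V W := fun ⟨R, hR, h⟩ U => ⟨R, hR, hR.val V W h U⟩

/-- Coinduction: relating terms by the right-hand side, and values by similarity, gives a
simulation, so it lies inside the largest one. -/
theorem similarity_tm_iff (hG : IsRelator T.obj T.map G) {M N : Tm S 0} :
    (similarity T G).tm M N ↔ G (similarity T G).val (eval T M) (eval T N) := by
  refine ⟨(similarity_isSimulation hG).tm M N, fun h => ?_⟩
  exact ⟨⟨fun M N => G (similarity T G).val (eval T M) (eval T N), (similarity T G).val⟩,
    ⟨fun _ _ h => h, fun V W hV U =>
      (similarity_isSimulation hG).tm _ _ ((similarity_isSimulation hG).val V W hV U)⟩, h⟩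

theorem similarity_val_iff (hG : IsRelator T.obj T.map G) {V W : Val S 0} :
    (similarity T G).val V W ↔ ∀ U, (similarity T G).tm (.app V U) (.app W U) := by
  refine ⟨(similarity_isSimulation hG).val V W, fun h => ?_⟩
  refine ⟨⟨(similarity T G).tm, fun V W => ∀ U, (similarity T G).tm (.app V U) (.app W U)⟩,
    ⟨fun M N h => ?_, fun V W h => h⟩, h⟩
  exact hG.mono _ _ (fun V W => (similarity_isSimulation hG).val V W) _ _
    ((similarity_isSimulation hG).tm M N h)

theorem similarity_refl (hG : IsRelator T.obj T.map G) :
    (∀ M, (similarity T G).tm M M) ∧ ∀ V, (similarity T G).val V V := by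
  have h : IsSimulation T G ⟨fun M N => M = N, fun V W => V = W⟩ :=
    ⟨fun M N h => hG.eq_sub _ _ (congrArg (eval T) h), fun V W h U => congrArg (Tm.app · U) h⟩
  exact ⟨fun M => ⟨_, h, rfl⟩, fun V => ⟨_, h, rfl⟩⟩

theorem similarity_trans (hG : IsRelator T.obj T.map G) :
    (∀ {L M N}, (similarity T G).tm L M → (similarity T G).tm M N → (similarity T G).tm L N) ∧
    ∀ {U V W}, (similarity T G).val U V → (similarity T G).val V W →
      (similarity T G).val U W := by
  have hs := similarity_isSimulation hG
  have h : IsSimulation T G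
      ⟨fun L N => ∃ M, (similarity T G).tm L M ∧ (similarity T G).tm M N,
        fun U W => ∃ V, (similarity T G).val U V ∧ (similarity T G).val V W⟩ :=
    ⟨fun L N ⟨M, h₁, h₂⟩ => hG.comp_sub _ _ _ _ ⟨eval T M, hs.tm _ _ h₁, hs.tm _ _ h₂⟩,
      fun U W ⟨V, h₁, h₂⟩ X => ⟨.app V X, hs.val _ _ h₁ X, hs.val _ _ h₂ X⟩⟩
  exact ⟨fun h₁ h₂ => ⟨_, h, _, h₁, h₂⟩, fun h₁ h₂ => ⟨_, h, _, h₁, h₂⟩⟩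

theorem ClosedRel.openExt_subst_tm (R : ClosedRel S) {n m : ℕ} {M N : Tm S n}
    (h : R.openExt.tm n M N) (s : Fin n → Val S m) :
    R.openExt.tm m (M.subst s) (N.subst s) := fun t => by
  rw [Tm.subst_subst, Tm.subst_subst]
  exact h _

theorem ClosedRel.openExt_subst_val (R : ClosedRel S) {n m : ℕ} {V W : Val S n}
    (h : R.openExt.val n V W) (s : Fin n → Val S m) :
    R.openExt.val m (V.subst s) (W.subst s) := fun t => by
  rw [Val.subst_subst, Val.subst_subst]
  exact h _

theorem ClosedRel.openExt_tm_zero (R : ClosedRel S) {M N : Tm S 0} :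
    R.openExt.tm 0 M N ↔ R.tm M N := by
  simp [ClosedRel.openExt]

theorem ClosedRel.openExt_val_zero (R : ClosedRel S) {V W : Val S 0} :
    R.openExt.val 0 V W ↔ R.val V W := by
  simp [ClosedRel.openExt]

end Similarity

/-! ## Howe's method -/

section Howe

variable {S : Signature.{u}}

mutual
/-- The Howe closure of a λ-term relation, on values. -/
inductive HoweVal (R : TermRel S) : ∀ n : ℕ, Val S n → Val S n → Prop
  | var {n : ℕ} {i : Fin n} {W : Val S n} : R.val n (.var i) W → HoweVal R n (.var i) W
  | lam {n : ℕ} {M N : Tm S (n + 1)} {W : Val S n} :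
      HoweTm R (n + 1) M N → R.val n (.lam N) W → HoweVal R n (.lam M) W
/-- The Howe closure of a λ-term relation, on terms. -/
inductive HoweTm (R : TermRel S) : ∀ n : ℕ, Tm S n → Tm S n → Prop
  | ret {n : ℕ} {V W : Val S n} {N : Tm S n} :
      HoweVal R n V W → R.tm n (.ret W) N → HoweTm R n (.ret V) N
  | app {n : ℕ} {V V' W W' : Val S n} {N : Tm S n} :
      HoweVal R n V V' → HoweVal R n W W' → R.tm n (.app V' W') N → HoweTm R n (.app V W) N
  | seq {n : ℕ} {M M' : Tm S n} {L L' : Tm S (n + 1)} {N : Tm S n} :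
      HoweTm R n M M' → HoweTm R (n + 1) L L' → R.tm n (.seq M' L') N → HoweTm R n (.seq M L) N
  | op {n : ℕ} {o : S.Op} {Ms Ns : Fin (S.arity o) → Tm S n} {N : Tm S n} :
      (∀ i, HoweTm R n (Ms i) (Ns i)) → R.tm n (.op o Ns) N → HoweTm R n (.op o Ms) N
end

/-- A λ-term relation that is a preorder and closed under substitution. -/
structure TermRel.IsSubstPreorder (R : TermRel S) : Prop where
  refl_tm : ∀ {n} M, R.tm n M M
  refl_val : ∀ {n} V, R.val n V V
  trans_tm : ∀ {n L M N}, R.tm n L M → R.tm n M N → R.tm n L N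
  trans_val : ∀ {n U V W}, R.val n U V → R.val n V W → R.val n U W
  subst_tm : ∀ {n m M N} (s : Fin n → Val S m), R.tm n M N → R.tm m (M.subst s) (N.subst s)
  subst_val : ∀ {n m V W} (s : Fin n → Val S m), R.val n V W → R.val m (V.subst s) (W.subst s)

variable {R : TermRel S}

theorem TermRel.IsSubstPreorder.rename_tm (hR : R.IsSubstPreorder) {n m : ℕ} {M N : Tm S n}
    (r : Fin n → Fin m) (h : R.tm n M N) : R.tm m (M.rename r) (N.rename r) := by
  rw [← Tm.subst_var, ← Tm.subst_var]
  exact hR.subst_tm _ h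

theorem TermRel.IsSubstPreorder.rename_val (hR : R.IsSubstPreorder) {n m : ℕ} {V W : Val S n}
    (r : Fin n → Fin m) (h : R.val n V W) : R.val m (V.rename r) (W.rename r) := by
  rw [← Val.subst_var, ← Val.subst_var]
  exact hR.subst_val _ h

/-- Every constructor of the closure ends with a step in `R`, which absorbs a further one by
transitivity. -/
theorem HoweVal.trans (hR : R.IsSubstPreorder) {n : ℕ} {U V W : Val S n}
    (h : HoweVal R n U V) (h' : R.val n V W) : HoweVal R n U W := by
  cases h with
  | var h => exact .var (hR.trans_val h h')
  | lam h₁ h => exact .lam h₁ (hR.trans_val h h')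

theorem HoweTm.trans (hR : R.IsSubstPreorder) {n : ℕ} {L M N : Tm S n}
    (h : HoweTm R n L M) (h' : R.tm n M N) : HoweTm R n L N := by
  cases h with
  | ret h₁ h => exact .ret h₁ (hR.trans_tm h h')
  | app h₁ h₂ h => exact .app h₁ h₂ (hR.trans_tm h h')
  | seq h₁ h₂ h => exact .seq h₁ h₂ (hR.trans_tm h h')
  | op h₁ h => exact .op h₁ (hR.trans_tm h h')

mutual
theorem HoweVal.refl (hR : R.IsSubstPreorder) : ∀ {n : ℕ} (V : Val S n), HoweVal R n V V
  | _, .var _ => .var (hR.refl_val _)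
  | _, .lam M => .lam (HoweTm.refl hR M) (hR.refl_val _)
theorem HoweTm.refl (hR : R.IsSubstPreorder) : ∀ {n : ℕ} (M : Tm S n), HoweTm R n M M
  | _, .ret V => .ret (HoweVal.refl hR V) (hR.refl_tm _)
  | _, .app V W => .app (HoweVal.refl hR V) (HoweVal.refl hR W) (hR.refl_tm _)
  | _, .seq M N => .seq (HoweTm.refl hR M) (HoweTm.refl hR N) (hR.refl_tm _)
  | _, .op _ Ms => .op (fun i => HoweTm.refl hR (Ms i)) (hR.refl_tm _)
end

mutual
theorem HoweVal.rename (hR : R.IsSubstPreorder) : ∀ {n m : ℕ} (r : Fin n → Fin m) {V W : Val S n},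
    HoweVal R n V W → HoweVal R m (V.rename r) (W.rename r)
  | _, _, r, _, _, .var h => by
      have := hR.rename_val r h
      simp only [Val.rename] at this ⊢
      exact .var this
  | _, _, r, _, _, .lam h₁ h => by
      have := hR.rename_val r h
      simp only [Val.rename] at this ⊢
      exact .lam (HoweTm.rename hR _ h₁) this
theorem HoweTm.rename (hR : R.IsSubstPreorder) : ∀ {n m : ℕ} (r : Fin n → Fin m) {M N : Tm S n},
    HoweTm R n M N → HoweTm R m (M.rename r) (N.rename r)
  | _, _, r, _, _, .ret h₁ h => by
      have := hR.rename_tm r h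
      simp only [Tm.rename] at this ⊢
      exact .ret (HoweVal.rename hR _ h₁) this
  | _, _, r, _, _, .app h₁ h₂ h => by
      have := hR.rename_tm r h
      simp only [Tm.rename] at this ⊢
      exact .app (HoweVal.rename hR _ h₁) (HoweVal.rename hR _ h₂) this
  | _, _, r, _, _, .seq h₁ h₂ h => by
      have := hR.rename_tm r h
      simp only [Tm.rename] at this ⊢
      exact .seq (HoweTm.rename hR _ h₁) (HoweTm.rename hR _ h₂) this
  | _, _, r, _, _, .op h₁ h => by
      have := hR.rename_tm r h
      simp only [Tm.rename] at this ⊢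
      exact .op (fun i => HoweTm.rename hR _ (h₁ i)) this
end

theorem HoweVal.liftSub (hR : R.IsSubstPreorder) {n m : ℕ} {s t : Fin n → Val S m}
    (h : ∀ i, HoweVal R m (s i) (t i)) (i : Fin (n + 1)) :
    HoweVal R (m + 1) (liftSub s i) (liftSub t i) := by
  cases i using Fin.cases with
  | zero => exact HoweVal.refl hR _
  | succ i => exact HoweVal.rename hR _ (h i)

-- The substitutions on the two sides may differ, provided that they are pointwise related. Beta
-- reduction and sequencing need this form, because there the substituted values are themselves
-- related only by the closure.
mutual
theorem HoweVal.subst (hR : R.IsSubstPreorder) : ∀ {n m : ℕ} {s t : Fin n → Val S m}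
    (_ : ∀ i, HoweVal R m (s i) (t i)) {V W : Val S n},
    HoweVal R n V W → HoweVal R m (V.subst s) (W.subst t)
  | _, _, s, t, hst, _, _, .var h => by
      have := hR.subst_val t h
      simp only [Val.subst] at this ⊢
      exact (hst _).trans hR this
  | _, _, s, t, hst, _, _, .lam h₁ h => by
      have := hR.subst_val t h
      simp only [Val.subst] at this ⊢
      exact .lam (HoweTm.subst hR (HoweVal.liftSub hR hst) h₁) this
theorem HoweTm.subst (hR : R.IsSubstPreorder) : ∀ {n m : ℕ} {s t : Fin n → Val S m}
    (_ : ∀ i, HoweVal R m (s i) (t i)) {M N : Tm S n},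
    HoweTm R n M N → HoweTm R m (M.subst s) (N.subst t)
  | _, _, s, t, hst, _, _, .ret h₁ h => by
      have := hR.subst_tm t h
      simp only [Tm.subst] at this ⊢
      exact .ret (HoweVal.subst hR hst h₁) this
  | _, _, s, t, hst, _, _, .app h₁ h₂ h => by
      have := hR.subst_tm t h
      simp only [Tm.subst] at this ⊢
      exact .app (HoweVal.subst hR hst h₁) (HoweVal.subst hR hst h₂) this
  | _, _, s, t, hst, _, _, .seq h₁ h₂ h => by
      have := hR.subst_tm t h
      simp only [Tm.subst] at this ⊢
      exact .seq (HoweTm.subst hR hst h₁) (HoweTm.subst hR (HoweVal.liftSub hR hst) h₂) this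
  | _, _, s, t, hst, _, _, .op h₁ h => by
      have := hR.subst_tm t h
      simp only [Tm.subst] at this ⊢
      exact .op (fun i => HoweTm.subst hR hst (h₁ i)) this
end

variable {T : EffectMonad S} {G : Lifting T.obj}

theorem similarity_isSubstPreorder (hG : IsRelator T.obj T.map G) :
    (similarity T G).openExt.IsSubstPreorder where
  refl_tm _ _ := (similarity_refl hG).1 _
  refl_val _ _ := (similarity_refl hG).2 _
  trans_tm h₁ h₂ s := (similarity_trans hG).1 (h₁ s) (h₂ s)
  trans_val h₁ h₂ s := (similarity_trans hG).2 (h₁ s) (h₂ s)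
  subst_tm s h := ClosedRel.openExt_subst_tm _ h s
  subst_val s h := ClosedRel.openExt_subst_val _ h s

/-- Relatedness in the Howe closure of similarity is preserved by evaluation. -/
theorem HoweTm.approx (hT : IsContinuous T) (hG : IsMonadRelator T G) (hI : IsInductive T G)
    (hO : RespectsOps T G) : ∀ (n : ℕ) {M N : Tm S 0},
    HoweTm (similarity T G).openExt 0 M N →
      G (HoweVal (similarity T G).openExt 0) (approx T n M) (eval T N)
  | 0, M, N, _ => by
      rw [EffCalc.approx]
      exact hI.bot_left _ _
  | n + 1, M, N, h => by
      have hR := similarity_isSubstPreorder hG.isRelator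
      -- The trailing similarity step of a constructor is absorbed, so it is enough to compare with
      -- a term that has the same head constructor as the left one.
      have key : ∀ {N' : Tm S 0} {a : T.obj (Val S 0)},
          (similarity T G).openExt.tm 0 N' N →
          G (HoweVal (similarity T G).openExt 0) a (eval T N') →
          G (HoweVal (similarity T G).openExt 0) a (eval T N) := by
        intro N' a hN ha
        refine hG.isRelator.trans (fun U V W h₁ h₂ => ?_) ha
          ((similarity_tm_iff hG.isRelator).1 ((ClosedRel.openExt_tm_zero _).1 hN))
        exact HoweVal.trans hR h₁ ((ClosedRel.openExt_val_zero _).2 h₂)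
      have ih := fun {M N : Tm S 0} => HoweTm.approx hT hG hI hO n (M := M) (N := N)
      cases h with
      | ret h₁ h =>
        refine key h ?_
        rw [EffCalc.approx, eval_ret hT]
        exact hG.lax_unit _ _ _ h₁
      | @app _ _ _ _ W' _ h₁ h₂ h =>
        refine key h ?_
        cases h₁ with
        | var h => exact Fin.elim0 (by assumption)
        | @lam _ M M' V' h₁ h₃ =>
          rw [EffCalc.approx]
          -- The right-hand function `V'` is only similar to the abstraction of `M'`. The bodies are
          -- therefore compared first, and the simulation clause for values, at the argument `W'`,
          -- then passes from that abstraction to `V'`.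
          have h₄ := (similarity_val_iff hG.isRelator).1 ((ClosedRel.openExt_val_zero _).1 h₃)
          refine hG.isRelator.trans (Q := (similarity T G).val) (fun U V W h₁ h₂ => ?_)
            (ih (HoweTm.subst hR (fun _ => h₂) h₁)) ?_
          · exact HoweVal.trans hR h₁ ((ClosedRel.openExt_val_zero _).2 h₂)
          · have := (similarity_tm_iff hG.isRelator).1 (h₄ W')
            rwa [eval_app hT] at this
      | seq h₁ h₂ h =>
        refine key h ?_
        rw [EffCalc.approx, eval_seq hT]
        refine hG.lax_bind _ _ _ _ (fun V W hVW => ?_) _ _ (ih h₁)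
        exact ih (HoweTm.subst hR (fun _ => hVW) h₂)
      | op h₁ h =>
        refine key h ?_
        rw [EffCalc.approx, eval_op hT]
        exact hO _ _ _ _ fun i => ih (h₁ i)

theorem HoweTm.eval (hT : IsContinuous T) (hG : IsMonadRelator T G) (hI : IsInductive T G)
    (hO : RespectsOps T G) {M N : Tm S 0} (h : HoweTm (similarity T G).openExt 0 M N) :
    G (HoweVal (similarity T G).openExt 0) (eval T M) (eval T N) := by
  rw [eval_eq_ωSup hT M]
  exact hI.sup_left _ _ _ fun n => HoweTm.approx hT hG hI hO n h

theorem howe_isSimulation (hT : IsContinuous T) (hG : IsMonadRelator T G) (hI : IsInductive T G)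
    (hO : RespectsOps T G) : IsSimulation T G
      ⟨HoweTm (similarity T G).openExt 0, HoweVal (similarity T G).openExt 0⟩ where
  tm _ _ h := HoweTm.eval hT hG hI hO h
  val _ _ h U :=
    have hR := similarity_isSubstPreorder hG.isRelator
    .app h (HoweVal.refl hR U) (hR.refl_tm _)

/-- Open terms reduce to closed ones: a closing substitution is related to itself by reflexivity, so
substitutivity of the closure applies. -/
theorem howe_sub_similarity (hT : IsContinuous T) (hG : IsMonadRelator T G)
    (hI : IsInductive T G) (hO : RespectsOps T G) :
    TermRel.Sub ⟨HoweTm (similarity T G).openExt, HoweVal (similarity T G).openExt⟩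
      (similarity T G).openExt :=
  have hR := similarity_isSubstPreorder hG.isRelator
  ⟨fun _ _ _ h s => ⟨_, howe_isSimulation hT hG hI hO,
      HoweTm.subst hR (fun i => HoweVal.refl hR (s i)) h⟩,
    fun _ _ _ h s => ⟨_, howe_isSimulation hT hG hI hO,
      HoweVal.subst hR (fun i => HoweVal.refl hR (s i)) h⟩⟩

theorem TermRel.IsSubstPreorder.sub_howe_tm (hR : R.IsSubstPreorder) {n : ℕ} {M N : Tm S n}
    (h : R.tm n M N) : HoweTm R n M N :=
  (HoweTm.refl hR M).trans hR h

theorem TermRel.IsSubstPreorder.sub_howe_val (hR : R.IsSubstPreorder) {n : ℕ} {V W : Val S n}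
    (h : R.val n V W) : HoweVal R n V W :=
  (HoweVal.refl hR V).trans hR h

/-- Similarity for an inductive relator that respects the operations is a precongruence. -/
theorem similarity_isPrecongruence (hT : IsContinuous T) (hG : IsMonadRelator T G)
    (hI : IsInductive T G) (hO : RespectsOps T G) :
    (similarity T G).openExt.IsPrecongruence := by
  have hR := similarity_isSubstPreorder hG.isRelator
  have hs := howe_sub_similarity hT hG hI hO
  exact
    { compatible :=
      { var := fun n i => hR.refl_val _
        lam := fun n M N h => hs.2 _ _ _ (.lam (hR.sub_howe_tm h) (hR.refl_val _))
        ret := fun n V W h => hs.1 _ _ _ (.ret (hR.sub_howe_val h) (hR.refl_tm _))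
        app := fun n V V' W W' h₁ h₂ =>
          hs.1 _ _ _ (.app (hR.sub_howe_val h₁) (hR.sub_howe_val h₂) (hR.refl_tm _))
        seq := fun n M M' N N' h₁ h₂ =>
          hs.1 _ _ _ (.seq (hR.sub_howe_tm h₁) (hR.sub_howe_tm h₂) (hR.refl_tm _))
        op := fun n o Ms Ns h =>
          hs.1 _ _ _ (.op (fun i => hR.sub_howe_tm (h i)) (hR.refl_tm _)) }
      refl_tm := fun _ _ => hR.refl_tm _
      refl_val := fun _ _ => hR.refl_val _
      trans_tm := fun _ _ _ _ => hR.trans_tm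
      trans_val := fun _ _ _ _ => hR.trans_val }

-- From similarity to the contextual preorder and equivalence.

theorem similarity_isPreadequate (hG : IsRelator T.obj T.map G) :
    (similarity T G).openExt.IsPreadequate T G := fun _ _ h =>
  hG.mono _ _ (fun _ _ _ => trivial) _ _
    ((similarity_tm_iff hG).1 ((ClosedRel.openExt_tm_zero _).1 h))

theorem TermRel.IsCompatible.sub_ctxPreorder {R : TermRel S} (hR : R.IsCompatible)
    (hA : R.IsPreadequate T G) : R.Sub (ctxPreorder T G) :=
  ⟨fun _ _ _ h => ⟨R, hR, hA, h⟩, fun _ _ _ h => ⟨R, hR, hA, h⟩⟩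

theorem twoWaySimilarity_isCongruence (hT : IsContinuous T) (hG : IsMonadRelator T G)
    (hI : IsInductive T G) (hO : RespectsOps T G) :
    (twoWaySimilarity T G).openExt.IsCongruence := by
  have hP := similarity_isPrecongruence hT hG hI hO
  have hC := hP.compatible
  exact
    { precongruence :=
      { compatible :=
        { var := fun n i s => ⟨hC.var n i s, hC.var n i s⟩
          lam := fun n M N h s =>
            ⟨hC.lam n M N (fun s => (h s).1) s, hC.lam n N M (fun s => (h s).2) s⟩
          ret := fun n V W h s =>
            ⟨hC.ret n V W (fun s => (h s).1) s, hC.ret n W V (fun s => (h s).2) s⟩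
          app := fun n V V' W W' h₁ h₂ s =>
            ⟨hC.app n V V' W W' (fun s => (h₁ s).1) (fun s => (h₂ s).1) s,
              hC.app n V' V W' W (fun s => (h₁ s).2) (fun s => (h₂ s).2) s⟩
          seq := fun n M M' N N' h₁ h₂ s =>
            ⟨hC.seq n M M' N N' (fun s => (h₁ s).1) (fun s => (h₂ s).1) s,
              hC.seq n M' M N' N (fun s => (h₁ s).2) (fun s => (h₂ s).2) s⟩
          op := fun n o Ms Ns h s =>
            ⟨hC.op n o Ms Ns (fun i s => (h i s).1) s,
              hC.op n o Ns Ms (fun i s => (h i s).2) s⟩ }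
        refl_tm := fun n M s => ⟨hP.refl_tm n M s, hP.refl_tm n M s⟩
        refl_val := fun n V s => ⟨hP.refl_val n V s, hP.refl_val n V s⟩
        trans_tm := fun n L M N h₁ h₂ s =>
          ⟨hP.trans_tm n L M N (fun s => (h₁ s).1) (fun s => (h₂ s).1) s,
            hP.trans_tm n N M L (fun s => (h₂ s).2) (fun s => (h₁ s).2) s⟩
        trans_val := fun n U V W h₁ h₂ s =>
          ⟨hP.trans_val n U V W (fun s => (h₁ s).1) (fun s => (h₂ s).1) s,
            hP.trans_val n W V U (fun s => (h₂ s).2) (fun s => (h₁ s).2) s⟩ }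
      symm_tm := fun n M N h s => (h s).symm
      symm_val := fun n V W h s => (h s).symm }

theorem twoWaySimilarity_sub_ctxEquiv (hT : IsContinuous T) (hG : IsMonadRelator T G)
    (hI : IsInductive T G) (hO : RespectsOps T G) :
    (twoWaySimilarity T G).openExt.Sub (ctxEquiv T G) := by
  refine (twoWaySimilarity_isCongruence hT hG hI hO).precongruence.compatible.sub_ctxPreorder ?_
  intro M N h
  have hA := similarity_isPreadequate hG.isRelator
  exact ⟨hA M N fun s => (h s).1, hA N M fun s => (h s).2⟩

/-- A simulation for the symmetrised lifting is a simulation for `G`, and so is its converse; the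
clause for values does not mention the lifting. -/
theorem bisimilarity_le_twoWaySimilarity :
    (∀ M N, (bisimilarity T G).tm M N → (twoWaySimilarity T G).tm M N) ∧
    ∀ V W, (bisimilarity T G).val V W → (twoWaySimilarity T G).val V W := by
  have h₁ : ∀ {R : ClosedRel S}, IsSimulation T (G.inter G.conv) R → IsSimulation T G R :=
    fun hR => ⟨fun _ _ h => (hR.tm _ _ h).1, hR.val⟩
  have h₂ : ∀ {R : ClosedRel S}, IsSimulation T (G.inter G.conv) R →
      IsSimulation T G ⟨fun M N => R.tm N M, fun V W => R.val W V⟩ :=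
    fun hR => ⟨fun _ _ h => (hR.tm _ _ h).2, fun _ _ => hR.val _ _⟩
  exact ⟨fun _ _ ⟨R, hR, h⟩ => ⟨⟨R, h₁ hR, h⟩, ⟨_, h₂ hR, h⟩⟩,
    fun _ _ ⟨R, hR, h⟩ => ⟨⟨R, h₁ hR, h⟩, ⟨_, h₂ hR, h⟩⟩⟩

theorem bisimilarity_sub_ctxEquiv (hT : IsContinuous T) (hG : IsMonadRelator T G)
    (hI : IsInductive T G) (hO : RespectsOps T G) :
    (bisimilarity T G).openExt.Sub (ctxEquiv T G) := by
  have h := twoWaySimilarity_sub_ctxEquiv hT hG hI hO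
  exact ⟨fun n M N hM => h.1 n M N fun s => bisimilarity_le_twoWaySimilarity.1 _ _ (hM s),
    fun n V W hV => h.2 n V W fun s => bisimilarity_le_twoWaySimilarity.2 _ _ (hV s)⟩

end Howe

end EffCalc

namespace EffCalc

/-! ## Subdistributions -/

section Subdistributions

open MeasureTheory

/-- Monotone convergence for sums: the sum is a supremum of finite sums, and the two suprema
commute. -/
theorem tsum_iSup_of_monotone {X : Type u} {f : X → ℕ → ℝ≥0∞} (hf : ∀ x, Monotone (f x)) :
    ∑' x, ⨆ n, f x n = ⨆ n, ∑' x, f x n := by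
  simp_rw [ENNReal.tsum_eq_iSup_sum]
  rw [iSup_comm]
  exact iSup_congr fun s => ENNReal.finsetSum_iSup_of_monotone hf

namespace Subdist

variable {X Y Z : Type u}

theorem ext {m k : Subdist X} (h : ∀ x, m x = k x) : m = k :=
  Subtype.ext (funext h)

theorem ωSup_apply (c : Chain (Subdist X)) (x : X) : (ωSup c : Subdist X) x = ⨆ n, (c n) x := rfl

/-- The expectation of a function with respect to a subdistribution. -/
noncomputable def expect (m : Subdist X) (h : X → ℝ≥0∞) : ℝ≥0∞ := ∑' x, m x * h x

theorem bind_apply (m : Subdist X) (f : X → Subdist Y) (y : Y) :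
    (m.bind f) y = m.expect fun x => f x y := rfl

theorem mass_eq_expect (m : Subdist X) (U : Set X) : m.mass U = m.expect (U.indicator 1) := by
  classical
  rw [mass, tsum_subtype U m.1, expect]
  refine tsum_congr fun x => ?_
  by_cases hx : x ∈ U <;> simp [hx]

theorem expect_mono {m k : Subdist X} (hm : m ≤ k) {g h : X → ℝ≥0∞} (hgh : ∀ x, g x ≤ h x) :
    m.expect g ≤ k.expect h :=
  ENNReal.tsum_le_tsum fun x => mul_le_mul' (hm x) (hgh x)

theorem mass_mono (m : Subdist X) {U V : Set X} (h : U ⊆ V) : m.mass U ≤ m.mass V :=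
  ENNReal.tsum_mono_subtype m.1 h

theorem mass_le_one (m : Subdist X) (U : Set X) : m.mass U ≤ 1 :=
  (ENNReal.tsum_comp_le_tsum_of_injective Subtype.val_injective m.1).trans m.2

theorem expect_dirac (x : X) (h : X → ℝ≥0∞) : (dirac x).expect h = h x := by
  classical
  rw [expect, tsum_eq_single x]
  · simp [dirac]
  · intro y hy
    simp [dirac, hy]

theorem expect_bind (m : Subdist X) (f : X → Subdist Y) (h : Y → ℝ≥0∞) :
    (m.bind f).expect h = m.expect fun x => (f x).expect h := by
  simp_rw [expect, bind_apply, expect, ← ENNReal.tsum_mul_right, ← ENNReal.tsum_mul_left]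
  rw [ENNReal.tsum_comm]
  simp_rw [mul_assoc]

theorem expect_mix (p : unitInterval) (m k : Subdist X) (h : X → ℝ≥0∞) :
    (mix p m k).expect h =
      ENNReal.ofReal (p : ℝ) * m.expect h + ENNReal.ofReal (1 - (p : ℝ)) * k.expect h := by
  simp_rw [expect, ← ENNReal.tsum_mul_left]
  rw [← ENNReal.tsum_add]
  refine tsum_congr fun x => ?_
  simp only [mix]
  rw [add_mul, mul_assoc, mul_assoc]

theorem expect_ωSup (c : Chain (Subdist X)) (h : X → ℝ≥0∞) :
    (ωSup c : Subdist X).expect h = ⨆ n, (c n).expect h := by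
  simp_rw [expect, ωSup_apply, ENNReal.iSup_mul]
  exact tsum_iSup_of_monotone fun x i j hij => mul_le_mul' (c.monotone hij x) le_rfl

theorem expect_iSup (m : Subdist X) (f : ℕ → X → ℝ≥0∞) (hf : Monotone f) :
    (m.expect fun x => ⨆ n, f n x) = ⨆ n, m.expect (f n) := by
  simp_rw [expect, ENNReal.mul_iSup]
  exact tsum_iSup_of_monotone fun x i j hij => mul_le_mul' le_rfl (hf hij x)

theorem dirac_bind (x : X) (f : X → Subdist Y) : (dirac x).bind f = f x :=
  ext fun y => by rw [bind_apply, expect_dirac]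

theorem bind_dirac (m : Subdist X) : m.bind dirac = m := by
  classical
  refine ext fun y => ?_
  rw [bind_apply, expect, tsum_eq_single y]
  · simp [dirac]
  · intro x hx
    simp [dirac, hx.symm]

theorem bind_assoc (m : Subdist X) (f : X → Subdist Y) (g : Y → Subdist Z) :
    (m.bind f).bind g = m.bind fun x => (f x).bind g :=
  ext fun z => by simp_rw [bind_apply, expect_bind]

theorem mix_bind (p : unitInterval) (m k : Subdist X) (f : X → Subdist Y) :
    (mix p m k).bind f = mix p (m.bind f) (k.bind f) :=
  ext fun y => by rw [bind_apply, expect_mix]; rfl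

theorem mass_bind (m : Subdist X) (f : X → Subdist Y) (U : Set Y) :
    (m.bind f).mass U = m.expect fun x => (f x).mass U := by
  simp_rw [mass_eq_expect, expect_bind]

theorem mass_map (m : Subdist X) (f : X → Y) (U : Set Y) :
    (m.bind fun x => dirac (f x)).mass U = m.mass (f ⁻¹' U) := by
  rw [mass_bind, mass_eq_expect]
  simp_rw [mass_eq_expect, expect_dirac]
  rfl

-- Continuity of bind and of probabilistic choice.

theorem bind_ωScottContinuous_left (f : X → Subdist Y) :
    ωScottContinuous fun m : Subdist X => m.bind f :=
  .of_monotone_map_ωSup ⟨fun _ _ h _ => expect_mono h fun _ => le_rfl,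
    fun c => ext fun _ => expect_ωSup c _⟩

theorem bind_ωScottContinuous_right (m : Subdist X) :
    ωScottContinuous fun f : X → Subdist Y => m.bind f :=
  .of_monotone_map_ωSup ⟨fun _ _ h _ => expect_mono le_rfl fun x => h x _,
    fun c => ext fun y => expect_iSup m (fun n x => c n x y) fun _ _ hij x => c.monotone hij x y⟩

theorem mix_mono (p : unitInterval) {m m' k k' : Subdist X} (hm : m ≤ m') (hk : k ≤ k') :
    mix p m k ≤ mix p m' k' := fun x =>
  add_le_add (mul_le_mul' le_rfl (hm x)) (mul_le_mul' le_rfl (hk x))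

theorem mix_ωSup (p : unitInterval) (c d : Chain (Subdist X)) (x : X) :
    (mix p (ωSup c) (ωSup d)) x = ⨆ n, (mix p (c n) (d n)) x := by
  simp only [mix, ωSup_apply, ENNReal.mul_iSup]
  exact ENNReal.iSup_add_iSup_of_monotone
    (fun i j hij => mul_le_mul' le_rfl (c.monotone hij x))
    (fun i j hij => mul_le_mul' le_rfl (d.monotone hij x))

/-- The discrete measure given by a subdistribution. -/
noncomputable def toMeasure (m : Subdist X) : @Measure X ⊤ :=
  letI : MeasurableSpace X := ⊤
  Measure.sum fun x => m x • Measure.dirac x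

theorem lintegral_toMeasure (m : Subdist X) (h : X → ℝ≥0∞) :
    @lintegral X ⊤ m.toMeasure h = m.expect h := by
  let : MeasurableSpace X := ⊤
  rw [toMeasure, lintegral_sum_measure, expect]
  refine tsum_congr fun x => ?_
  rw [lintegral_smul_measure, lintegral_dirac' _ measurable_from_top, smul_eq_mul]

theorem toMeasure_apply (m : Subdist X) (U : Set X) :
    @DFunLike.coe _ _ _ (@Measure.instFunLike X ⊤) m.toMeasure U = m.mass U := by
  let : MeasurableSpace X := ⊤
  rw [mass_eq_expect, ← lintegral_toMeasure, lintegral_indicator_one MeasurableSpace.measurableSet_top]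

/-- The layer cake formula for expectations. -/
theorem expect_eq_lintegral_mass (m : Subdist X) {h : X → ℝ≥0∞} (hh : ∀ x, h x ≤ 1) :
    m.expect h = ∫⁻ t in Set.Ioi (0 : ℝ), m.mass {x | t < (h x).toReal} := by
  let : MeasurableSpace X := ⊤
  have := lintegral_eq_lintegral_meas_lt m.toMeasure (f := fun x => (h x).toReal)
    (Filter.Eventually.of_forall fun x => ENNReal.toReal_nonneg) measurable_from_top.aemeasurable
  simp_rw [toMeasure_apply, lintegral_toMeasure] at this
  rw [← this]
  congr 1
  funext x
  -- The bound by `1` makes `h` finite, so nothing is lost in passing to real values.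
  rw [ENNReal.ofReal_toReal ((hh x).trans_lt ENNReal.one_lt_top).ne]

end Subdist

-- The simulation relator on subdistributions.

open Subdist

/-- If `g x > t` and `R x y`, then `h y > t`. So `R` sends each superlevel set of `g` into that of
`h`, their masses compare by hypothesis, and integrating over `t` compares the expectations. -/
theorem subdistRelator.expect_le {X Y : Type u} {R : X → Y → Prop} {m : Subdist X}
    {k : Subdist Y} (hmk : subdistRelator R m k) {g : X → ℝ≥0∞} {h : Y → ℝ≥0∞}
    (hg : ∀ x, g x ≤ 1) (hh : ∀ y, h y ≤ 1) (hR : ∀ x y, R x y → g x ≤ h y) :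
    m.expect g ≤ k.expect h := by
  rw [expect_eq_lintegral_mass m hg, expect_eq_lintegral_mass k hh]
  refine lintegral_mono fun t => (hmk _).trans (mass_mono k ?_)
  rintro y ⟨x, hx, hxy⟩
  exact lt_of_lt_of_le hx
    (ENNReal.toReal_mono ((hh y).trans_lt ENNReal.one_lt_top).ne (hR x y hxy))

theorem subdistRelator_refl {X : Type u} {R : X → X → Prop} (hR : ∀ x, R x x) (m : Subdist X) :
    subdistRelator R m m :=
  fun _ => mass_mono m fun x hx => ⟨x, hx, hR x⟩

theorem subdistRelator.trans {X Y Z : Type u} {R : X → Y → Prop} {Q : Y → Z → Prop}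
    {m : Subdist X} {k : Subdist Y} {l : Subdist Z} (h₁ : subdistRelator R m k)
    (h₂ : subdistRelator Q k l) : subdistRelator (fun x z => ∃ y, R x y ∧ Q y z) m l :=
  fun U => (h₁ U).trans <| (h₂ _).trans <| mass_mono l
    fun _ ⟨y, ⟨x, hx, hxy⟩, hyz⟩ => ⟨x, hx, y, hxy, hyz⟩

theorem subdistRelator.mono {X Y : Type u} {R Q : X → Y → Prop} (h : ∀ x y, R x y → Q x y)
    {m : Subdist X} {k : Subdist Y} (hmk : subdistRelator R m k) : subdistRelator Q m k :=
  fun U => (hmk U).trans <| mass_mono k fun _ ⟨x, hx, hxy⟩ => ⟨x, hx, h _ _ hxy⟩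

/-- Masses of pushforwards are masses of preimages. From left to right the test set is the image `f
'' U`, whose preimage contains `U`. -/
theorem subdistRelator_map_iff {X Y Z W : Type u} (f : Z → X) (g : W → Y) (R : X → Y → Prop)
    (m : Subdist Z) (k : Subdist W) :
    subdistRelator R (m.bind fun z => dirac (f z)) (k.bind fun w => dirac (g w)) ↔
      subdistRelator (fun z w => R (f z) (g w)) m k := by
  refine ⟨fun h U => ?_, fun h U => ?_⟩
  · have := h (f '' U)
    rw [mass_map, mass_map] at this
    refine (mass_mono m (Set.subset_preimage_image f U)).trans (this.trans (mass_mono k ?_))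
    rintro w ⟨_, ⟨z, hz, rfl⟩, hzw⟩
    exact ⟨z, hz, hzw⟩
  · rw [mass_map, mass_map]
    exact (h _).trans (mass_mono k fun w ⟨z, hz, hzw⟩ => ⟨f z, hz, hzw⟩)

theorem subdistRelator_dirac {X Y : Type u} {R : X → Y → Prop} {x : X} {y : Y} (h : R x y) :
    subdistRelator R (dirac x) (dirac y) := fun U => by
  rw [mass_eq_expect, mass_eq_expect, expect_dirac, expect_dirac]
  by_cases hx : x ∈ U
  · have hy : y ∈ {y | ∃ x ∈ U, R x y} := ⟨x, hx, h⟩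
    rw [Set.indicator_of_mem hy]
    exact Set.indicator_le_self' (fun _ _ => zero_le) x
  · simp [hx]

/-- The mass of a bind is the expectation of the masses of the continuation, and these lie in `[0,
1]` and increase along `R`. -/
theorem subdistRelator.bind {X Y X' Y' : Type u} {R : X → Y → Prop} {Q : X' → Y' → Prop}
    {m : Subdist X} {k : Subdist Y} (hmk : subdistRelator R m k) {f : X → Subdist X'}
    {g : Y → Subdist Y'} (h : ∀ x y, R x y → subdistRelator Q (f x) (g y)) :
    subdistRelator Q (m.bind f) (k.bind g) := fun U => by
  rw [mass_bind, mass_bind]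
  exact hmk.expect_le (fun x => mass_le_one _ _) (fun y => mass_le_one _ _)
    fun x y hxy => h x y hxy U

theorem subdistRelator_mix {X Y : Type u} {R : X → Y → Prop} (p : unitInterval)
    {m m' : Subdist X} {k k' : Subdist Y} (h : subdistRelator R m k)
    (h' : subdistRelator R m' k') : subdistRelator R (mix p m m') (mix p k k') := fun U => by
  have h₁ := h U
  have h₂ := h' U
  simp only [mass_eq_expect, expect_mix] at h₁ h₂ ⊢
  gcongr

theorem subdistRelator_bot {X Y : Type u} (R : X → Y → Prop) (k : Subdist Y) :
    subdistRelator R ⊥ k := fun U => by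
  have : (⊥ : Subdist X).mass U = 0 := ENNReal.tsum_eq_zero.2 fun _ => rfl
  rw [this]
  exact zero_le

theorem subdistRelator_ωSup {X Y : Type u} {R : X → Y → Prop} {c : Chain (Subdist X)}
    {k : Subdist Y} (h : ∀ n, subdistRelator R (c n) k) : subdistRelator R (ωSup c) k :=
  fun U => by
    rw [mass_eq_expect, expect_ωSup]
    refine iSup_le fun n => ?_
    rw [← mass_eq_expect]
    exact h n U

end Subdistributions

/-! ## Subdistributions with exceptions -/

section ProbExc

variable (E : Type u)

theorem probExcMonad_isKleisliTriple : IsKleisliTriple (probExcMonad E) where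
  unit_bind x f := Subdist.dirac_bind _ _
  bind_unit m := by
    refine Eq.trans (congrArg (Subdist.bind m) ?_) (Subdist.bind_dirac m)
    funext u
    cases u <;> rfl
  bind_assoc m f g := by
    refine (Subdist.bind_assoc _ _ _).trans (congrArg (Subdist.bind m) ?_)
    funext u
    cases u with
    | inl x => rfl
    | inr e => exact Subdist.dirac_bind _ _

theorem probExcMonad_isContinuous : IsContinuous (probExcMonad E) where
  bind_left f := Subdist.bind_ωScottContinuous_left _
  bind_right {X Y} m := by
    refine ωScottContinuous.comp (Subdist.bind_ωScottContinuous_right (Y := Y ⊕ E) m)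
      (f := fun f : X → Subdist (Y ⊕ E) => Sum.elim f fun e => Subdist.dirac (Sum.inr e)) ?_
    refine .of_apply₂ fun u => ?_
    cases u with
    | inl x => exact ωScottContinuous.apply x
    | inr e => exact ωScottContinuous.const
  interp {X} o := by
    cases o with
    | choice p =>
      refine .of_monotone_map_ωSup ⟨fun ms ns h => ?_, fun c => Subdist.ext fun x => ?_⟩
      · exact Subdist.mix_mono p (h (0 : Fin 2)) (h (1 : Fin 2))
      · exact Subdist.mix_ωSup p (c.map (Pi.evalOrderHom (0 : Fin 2)))
          (c.map (Pi.evalOrderHom (1 : Fin 2))) x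
    | raise e => exact ωScottContinuous.const

-- The exception relator and the composite relator.

variable {E}

theorem excRelator_refl {X : Type u} {R : X → X → Prop} (hR : ∀ x, R x x) (u : X ⊕ E) :
    excRelator E R u u := by
  cases u with
  | inl x => exact .inl (hR x)
  | inr e => exact .inr rfl

theorem excRelator_trans {X Y Z : Type u} {R : X → Y → Prop} {Q : Y → Z → Prop} {u : X ⊕ E}
    {v : Y ⊕ E} {w : Z ⊕ E} (h₁ : excRelator E R u v) (h₂ : excRelator E Q v w) :
    excRelator E (fun x z => ∃ y, R x y ∧ Q y z) u w := by
  cases h₁ with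
  | inl h =>
    cases h₂ with
    | inl h' => exact .inl ⟨_, h, h'⟩
  | inr h =>
    cases h₂ with
    | inr h' => exact .inr (h.trans h')

theorem excRelator_mono {X Y : Type u} {R Q : X → Y → Prop} (h : ∀ x y, R x y → Q x y)
    {u : X ⊕ E} {v : Y ⊕ E} (huv : excRelator E R u v) : excRelator E Q u v := by
  cases huv with
  | inl h' => exact .inl (h _ _ h')
  | inr h' => exact .inr h'

theorem excRelator_map_iff {X Y Z W : Type u} (f : Z → X) (g : W → Y) (R : X → Y → Prop)
    (u : Z ⊕ E) (v : W ⊕ E) :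
    excRelator E R (Sum.map f id u) (Sum.map g id v) ↔
      excRelator E (fun z w => R (f z) (g w)) u v := by
  cases u <;> cases v <;> simp [excRelator]

/-- Since exceptions propagate, the functorial action is a pushforward along `Sum.map f id`, which
splits the preimage law into one law for each relator. -/
theorem probExcMonad_map {X Y : Type u} (f : X → Y) (m : Subdist (X ⊕ E)) :
    (probExcMonad E).map f m = m.bind fun u => Subdist.dirac (Sum.map f id u) := by
  refine congrArg (Subdist.bind m) ?_
  funext u
  cases u <;> rfl

variable (E)

theorem probExcRelator_isMonadRelator : IsMonadRelator (probExcMonad E) (probExcRelator E) where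
  isRelator :=
    { eq_sub := fun a b h => h ▸ subdistRelator_refl (excRelator_refl fun _ => rfl) a
      comp_sub := fun R Q a c ⟨b, h₁, h₂⟩ => (subdistRelator.trans h₁ h₂).mono
        fun u w ⟨v, h, h'⟩ => excRelator_trans h h'
      preimage := fun f g R a b => by
        refine Iff.trans ?_ (iff_of_eq (congrArg₂ (subdistRelator (excRelator E R))
          (probExcMonad_map f a) (probExcMonad_map g b)).symm)
        refine Iff.trans ?_ (subdistRelator_map_iff (Sum.map f id) (Sum.map g id) _ a b).symm
        simp_rw [excRelator_map_iff]
        rfl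
      mono := fun R Q h a b => subdistRelator.mono fun u v => excRelator_mono h }
  lax_unit R x y h := subdistRelator_dirac (.inl h)
  lax_bind f g R Q h a b hab := by
    refine subdistRelator.bind hab fun u v huv => ?_
    cases huv with
    | inl h' => exact h _ _ h'
    | inr h' => exact subdistRelator_dirac (.inr h')

theorem probExcRelator_isInductive : IsInductive (probExcMonad E) (probExcRelator E) where
  bot_left _ b := subdistRelator_bot _ b
  sup_left _ c _ h := subdistRelator_ωSup (c := c) h

theorem probExcRelator_respectsOps : RespectsOps (probExcMonad E) (probExcRelator E) := by
  intro X Y R o a b h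
  cases o with
  | choice p => exact subdistRelator_mix p (h (0 : Fin 2)) (h (1 : Fin 2))
  | raise e => exact subdistRelator_dirac (.inr rfl)

end ProbExc

end EffCalc

namespace EffCalc

/-! ## Closed terms under substitution -/

section Closed

variable {S : Signature.{u}}

@[simp] theorem Val.weaken_zero (V : Val S 0) : V.weaken = V := by
  rw [Val.weaken, show (Fin.elim0 : Fin 0 → Fin 0) = fun i => i from funext fun i => i.elim0,
    Val.rename_id]

@[simp] theorem Tm.weaken_zero (M : Tm S 0) : M.weaken = M := by
  rw [Tm.weaken, show (Fin.elim0 : Fin 0 → Fin 0) = fun i => i from funext fun i => i.elim0,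
    Tm.rename_id]

@[simp] theorem Val.rename_closed {n : ℕ} (V : Val S 0) (r : Fin 0 → Fin n) :
    V.rename r = V.weaken :=
  congrArg (fun r => V.rename r) (funext fun i => i.elim0)

@[simp] theorem Tm.rename_closed {n : ℕ} (M : Tm S 0) (r : Fin 0 → Fin n) :
    M.rename r = M.weaken :=
  congrArg (fun r => M.rename r) (funext fun i => i.elim0)

@[simp] theorem Val.weaken_rename {n m : ℕ} (V : Val S 0) (r : Fin n → Fin m) :
    (V.weaken).rename r = V.weaken := by
  rw [Val.weaken, Val.rename_rename, Val.rename_closed]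

@[simp] theorem Val.weaken_subst {n m : ℕ} (V : Val S 0) (s : Fin n → Val S m) :
    (V.weaken).subst s = V.weaken := by
  rw [Val.weaken, Val.subst_rename, Val.weaken, ← Val.subst_var]
  congr 1
  exact funext fun i => i.elim0

@[simp] theorem Tm.weaken_subst {n m : ℕ} (M : Tm S 0) (s : Fin n → Val S m) :
    (M.weaken).subst s = M.weaken := by
  rw [Tm.weaken, Tm.subst_rename, Tm.weaken, ← Tm.subst_var]
  congr 1
  exact funext fun i => i.elim0

end Closed

section Programs

variable {E : Type u}

-- The programs use literal de Bruijn indices, which `liftSub_succ` does not match syntactically.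
@[simp] theorem liftSub_one {S : Signature.{u}} {n m : ℕ} (s : Fin (n + 1) → Val S m) :
    liftSub s 1 = (s 0).rename Fin.succ := rfl

@[simp] theorem liftSub_two {S : Signature.{u}} {n m : ℕ} (s : Fin (n + 2) → Val S m) :
    liftSub s 2 = (s 1).rename Fin.succ := rfl

@[simp] theorem liftSub_three {S : Signature.{u}} {n m : ℕ} (s : Fin (n + 3) → Val S m) :
    liftSub s 3 = (s 2).rename Fin.succ := rfl

variable {n m : ℕ}

@[simp] theorem fair_subst (M N : Tm (probExcSig E) n) (s : Fin n → Val (probExcSig E) m) :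
    (fair M N).subst s = fair (M.subst s) (N.subst s) := by
  simp only [fair, Tm.subst]
  congr 1
  funext i
  split_ifs <;> rfl

@[simp] theorem raise_subst (e : E) (s : Fin n → Val (probExcSig E) m) :
    (raise e).subst s = raise e := by
  simp only [raise, Tm.subst]
  congr 1
  exact funext fun i : Fin 0 => i.elim0

@[simp] theorem compose_subst (M N : Tm (probExcSig E) n) (s : Fin n → Val (probExcSig E) m) :
    (compose M N).subst s = compose (M.subst s) (N.subst s) := by
  simp [compose, Tm.subst, Val.subst, Val.rename, Tm.subst_rename, Tm.rename_subst]
  rfl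

@[simp] theorem identity_subst (s : Fin n → Val (probExcSig E) m) :
    (identity).subst s = identity := by
  simp [identity, Tm.subst, Val.subst]

@[simp] theorem succNum_subst (V : Val (probExcSig E) n) (s : Fin n → Val (probExcSig E) m) :
    (succNum V).subst s = succNum (V.subst s) := by
  simp [succNum, Tm.subst, Val.subst, Val.subst_rename, Val.rename_subst]

@[simp] theorem num_subst (k : ℕ) (s : Fin n → Val (probExcSig E) m) :
    (num k).subst s = num k := by
  induction k with
  | zero => simp [num, Tm.subst, Val.subst, Val.rename]
  | succ k ih => rw [num, succNum_subst, ih]; rfl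

@[simp] theorem num_rename (k : ℕ) (r : Fin n → Fin m) :
    (num k : Val (probExcSig E) n).rename r = num k := by
  rw [← Val.subst_var, num_subst]

@[simp] theorem num_weaken (k : ℕ) : (num k : Val (probExcSig E) 0).weaken (n := n) = num k :=
  num_rename k _

@[simp] theorem progR_subst (V : Val (probExcSig E) 0) (k : Val (probExcSig E) n)
    (s : Fin n → Val (probExcSig E) m) : (progR V k).subst s = progR V (k.subst s) := by
  simp [progR, Tm.subst, Val.subst, Val.subst_rename, Val.rename_subst]

/-! ## Evaluation of programs -/

/-- The probability `1 / 2`. -/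
noncomputable abbrev oneHalf : unitInterval := ⟨1 / 2, by norm_num, by norm_num⟩

/-- Fair choice between computations. -/
noncomputable def fairMix {X : Type u} (m k : (probExcMonad E).obj X) : (probExcMonad E).obj X :=
  Subdist.mix oneHalf m k

/-- The computation that raises an exception. -/
noncomputable def raised {X : Type u} (e : E) : (probExcMonad E).obj X :=
  Subdist.dirac (Sum.inr e)

theorem fairMix_bind {X Y : Type u} (m k : (probExcMonad E).obj X)
    (f : X → (probExcMonad E).obj Y) :
    (probExcMonad E).bind (fairMix m k) f =
      fairMix ((probExcMonad E).bind m f) ((probExcMonad E).bind k f) :=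
  Subdist.mix_bind _ _ _ _

theorem raised_bind {X Y : Type u} (e : E) (f : X → (probExcMonad E).obj Y) :
    (probExcMonad E).bind (raised e) f = raised e :=
  Subdist.dirac_bind _ _

theorem eval_fair (M N : Tm (probExcSig E) 0) :
    eval (probExcMonad E) (fair M N) =
      fairMix (eval (probExcMonad E) M) (eval (probExcMonad E) N) :=
  eval_op (probExcMonad_isContinuous E) (.choice oneHalf) _

theorem eval_raise (e : E) :
    eval (probExcMonad E) (raise e) = raised e :=
  eval_op (probExcMonad_isContinuous E) (.raise e) _

/-- Self-applications and numerals applied to their zero branch both have this shape: the head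
returns a value without effect, so the unit law removes the sequencing. -/
theorem eval_seq_app_ret {S : Signature.{u}} {T : EffectMonad S} (hK : IsKleisliTriple T)
    (hT : IsContinuous T) (W : Val S 1) (U : Val S 0) (N : Tm S 1) :
    eval T (.seq (.app (.lam (.ret W)) U) N) = eval T (N.inst (W.subst fun _ => U)) := by
  rw [eval_seq hT, eval_app hT, Tm.inst, Tm.subst, eval_ret hT, hK.unit_bind]

/-- Composition of two closed function values. -/
def compVal (V W : Val (probExcSig E) 0) : Val (probExcSig E) 0 :=
  .lam (.seq (.app W.weaken (.var 0)) (.app V.weaken (.var 0)))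

theorem eval_compose (M N : Tm (probExcSig E) 0) :
    eval (probExcMonad E) (compose M N) =
      (probExcMonad E).bind (eval (probExcMonad E) M) fun V =>
        (probExcMonad E).bind (eval (probExcMonad E) N) fun W =>
          (probExcMonad E).unit (compVal V W) := by
  have hT := probExcMonad_isContinuous E
  rw [compose, eval_seq hT]
  congr 1
  funext V
  simp only [Tm.inst, Tm.subst, Tm.rename_closed, Tm.weaken_subst, Tm.weaken_zero]
  rw [eval_seq hT]
  congr 1
  funext W
  rw [← eval_ret hT]
  congr 1
  simp [Tm.inst, Tm.subst, Val.subst, compVal, Val.rename]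

theorem eval_app_compVal (V W U : Val (probExcSig E) 0) :
    eval (probExcMonad E) (.app (compVal V W) U) =
      (probExcMonad E).bind (eval (probExcMonad E) (.app W U)) fun Z =>
        eval (probExcMonad E) (.app V Z) := by
  have hT := probExcMonad_isContinuous E
  rw [compVal, eval_app hT]
  simp only [Tm.inst, Tm.subst, Val.subst, Val.weaken_subst, Val.weaken_zero]
  rw [eval_seq hT]
  congr 1
  funext Z
  simp [Tm.inst, Tm.subst, Val.subst]

theorem eval_progW (V : Val (probExcSig E) 0) (e : E) :
    eval (probExcMonad E) (progW V e) =
      eval (probExcMonad E) (fair (fair (.ret V) (raise e)) (compose (.ret V) (progW V e))) := by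
  rw [progW, wRec, eval_app (probExcMonad_isContinuous E), ← wRec]
  congr 1
  simp [Tm.inst, Tm.subst, Val.subst]

theorem eval_progT (V : Val (probExcSig E) 0) (e : E) (k : ℕ) :
    eval (probExcMonad E) (progT V e (num k)) =
      eval (probExcMonad E)
        (fair (fair (progR V (num k)) (raise e)) (progT V e (num (k + 1)))) := by
  have hT := probExcMonad_isContinuous E
  conv_lhs => rw [progT, Val.weaken_zero, sumRec,
    eval_seq_app_ret (probExcMonad_isKleisliTriple E) hT, ← sumRec]
  simp only [Tm.inst, Tm.subst, Val.subst, num_rename, num_subst]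
  rw [eval_app hT]
  congr 1
  simp [Tm.inst, Tm.subst, Val.subst, progT, Val.rename]
  rfl

/-- One unfolding of the recursion, before the numeral selects a branch. -/
theorem eval_progR (V : Val (probExcSig E) 0) (k : ℕ) :
    eval (probExcMonad E) (progR V (num k)) =
      eval (probExcMonad E)
        (.seq (.app (num k) (.lam (.ret identity)))
          (.app (.var 0) (.lam (compose (progR V (.var 0)) (.ret V.weaken))))) := by
  have hT := probExcMonad_isContinuous E
  conv_lhs => rw [progR, Val.weaken_zero, compRec,
    eval_seq_app_ret (probExcMonad_isKleisliTriple E) hT, ← compRec]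
  simp only [Tm.inst, Tm.subst, Val.subst, num_rename, num_subst]
  rw [eval_app hT]
  congr 1
  simp [Tm.inst, Tm.subst, Val.subst, progR, Val.rename]

theorem eval_progR_zero (V : Val (probExcSig E) 0) :
    eval (probExcMonad E) (progR V (num 0)) = eval (probExcMonad E) (.ret identity) := by
  have hT := probExcMonad_isContinuous E
  rw [eval_progR, num, eval_seq_app_ret (probExcMonad_isKleisliTriple E) hT]
  simp only [Tm.inst, Tm.subst, Val.subst]
  rw [eval_app hT]
  simp [Tm.inst, Tm.subst, Val.subst]
  rw [eval_app hT]
  simp [Tm.inst, Tm.subst]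

theorem eval_progR_succ (V : Val (probExcSig E) 0) (k : ℕ) :
    eval (probExcMonad E) (progR V (num (k + 1))) =
      eval (probExcMonad E) (compose (progR V (num k)) (.ret V)) := by
  have hT := probExcMonad_isContinuous E
  rw [eval_progR, num, succNum, eval_seq_app_ret (probExcMonad_isKleisliTriple E) hT]
  simp only [Tm.inst, Tm.subst, Val.subst]
  rw [eval_app hT]
  simp [Tm.inst, Tm.subst, Val.subst]
  rw [eval_app hT]
  simp [Tm.inst, Tm.subst, Val.subst]

end Programs

end EffCalc

namespace EffCalc

/-! ## The two recursions are bisimilar -/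

section Bisimilar

/-- Each unrolling halves the discrepancy, and values of subdistributions are at most `1`, so `n`
unrollings give `a j ≤ b j + 2⁻¹ ^ n` pointwise. The situation is symmetric in `a` and `b`. -/
theorem Subdist.eq_of_mix_oneHalf {X : Type u} {c a b : ℕ → Subdist X}
    (ha : ∀ j, a j = Subdist.mix oneHalf (c j) (a (j + 1)))
    (hb : ∀ j, b j = Subdist.mix oneHalf (c j) (b (j + 1))) (j : ℕ) : a j = b j := by
  have key : ∀ {a b : ℕ → Subdist X}, (∀ j, a j = Subdist.mix oneHalf (c j) (a (j + 1))) →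
      (∀ j, b j = Subdist.mix oneHalf (c j) (b (j + 1))) → ∀ j x, (a j) x ≤ (b j) x := by
    intro a b ha hb j x
    have happ : ∀ (m k : Subdist X),
        (Subdist.mix oneHalf m k) x = 2⁻¹ * m x + 2⁻¹ * k x := by
      intro m k
      have h₁ : ENNReal.ofReal (1 / 2) = 2⁻¹ := by
        rw [one_div, ENNReal.ofReal_inv_of_pos two_pos, ENNReal.ofReal_ofNat]
      have h₂ : ENNReal.ofReal (1 - 1 / 2) = 2⁻¹ := by
        rw [← h₁]
        norm_num
      change ENNReal.ofReal (1 / 2) * m x + ENNReal.ofReal (1 - 1 / 2) * k x = _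
      rw [h₁, h₂]
    have hle : ∀ n j, (a j) x ≤ (b j) x + 2⁻¹ ^ n := by
      intro n
      induction n with
      | zero =>
        intro j
        rw [pow_zero]
        exact ((ENNReal.le_tsum x).trans (a j).2).trans le_add_self
      | succ n ih =>
        intro j
        rw [ha j, hb j, happ, happ, add_assoc, pow_succ']
        exact add_le_add le_rfl ((mul_le_mul' le_rfl (ih (j + 1))).trans_eq (mul_add _ _ _))
    refine ge_of_tendsto' (f := fun n => (b j) x + 2⁻¹ ^ n) (x := Filter.atTop) ?_
      fun n => hle n j
    have := (tendsto_const_nhds (x := (b j) x)).add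
      (ENNReal.tendsto_pow_atTop_nhds_zero_of_lt_one ENNReal.one_half_lt_one)
    rwa [add_zero] at this
  exact Subdist.ext fun x => le_antisymm (key ha hb j x) (key hb ha j x)

variable {E : Type u}

/-- The left-nested powers `V`, `V ∘ V`, `V ∘ (V ∘ V)`, … -/
def powLeft (V : Val (probExcSig E) 0) : ℕ → Val (probExcSig E) 0
  | 0 => V
  | j + 1 => compVal V (powLeft V j)

/-- The right-nested powers `id`, `id ∘ V`, `(id ∘ V) ∘ V`, … -/
def powRight (V : Val (probExcSig E) 0) : ℕ → Val (probExcSig E) 0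
  | 0 => identity
  | j + 1 => compVal (powRight V j) V

/-- The iterates of `M ↦ COMP(V, M)` on `W`. -/
noncomputable def iterW (V : Val (probExcSig E) 0) (e : E) : ℕ → Tm (probExcSig E) 0
  | 0 => progW V e
  | j + 1 => compose (.ret V) (iterW V e j)

theorem eval_app_identity (U : Val (probExcSig E) 0) :
    eval (probExcMonad E) (.app identity U) = (probExcMonad E).unit U := by
  have hT := probExcMonad_isContinuous E
  rw [identity, eval_app hT, Tm.inst, Tm.subst, eval_ret hT, Val.subst]

/-- `V` commutes with its own powers under Kleisli composition; associativity of bind moves the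
final `V` inside the inner power. -/
theorem eval_app_powRight_bind (V : Val (probExcSig E) 0) (j : ℕ) :
    ∀ U, (probExcMonad E).bind (eval (probExcMonad E) (.app (powRight V j) U))
      (fun Z => eval (probExcMonad E) (.app V Z)) =
        eval (probExcMonad E) (.app (powRight V (j + 1)) U) := by
  have hK := probExcMonad_isKleisliTriple E
  induction j with
  | zero =>
    intro U
    simp only [powRight, eval_app_compVal, eval_app_identity]
    rw [hK.unit_bind, hK.bind_unit]
  | succ j ih =>
    intro U
    rw [powRight, eval_app_compVal, hK.bind_assoc]
    simp_rw [ih]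
    rw [← eval_app_compVal, ← powRight]

/-- The shift arises because left-nested powers start at `V` and right-nested ones at the identity.
-/
theorem eval_app_powLeft (V : Val (probExcSig E) 0) (j : ℕ) (U : Val (probExcSig E) 0) :
    eval (probExcMonad E) (.app (powLeft V j) U) =
      eval (probExcMonad E) (.app (powRight V (j + 1)) U) := by
  induction j with
  | zero =>
    rw [powRight, powRight, powLeft, eval_app_compVal]
    simp_rw [eval_app_identity]
    rw [(probExcMonad_isKleisliTriple E).bind_unit]
  | succ j ih => rw [powLeft, eval_app_compVal, ih, eval_app_powRight_bind]

theorem eval_progR_num (V : Val (probExcSig E) 0) (j : ℕ) :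
    eval (probExcMonad E) (progR V (num j)) = (probExcMonad E).unit (powRight V j) := by
  have hK := probExcMonad_isKleisliTriple E
  have hT := probExcMonad_isContinuous E
  induction j with
  | zero => rw [eval_progR_zero, eval_ret hT, powRight]
  | succ j ih =>
    rw [eval_progR_succ, eval_compose, ih, hK.unit_bind, eval_ret hT, hK.unit_bind, powRight]

theorem eval_compose_ret (V : Val (probExcSig E) 0) (M : Tm (probExcSig E) 0) :
    eval (probExcMonad E) (compose (.ret V) M) =
      (probExcMonad E).bind (eval (probExcMonad E) M) fun W =>
        (probExcMonad E).unit (compVal V W) := by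
  rw [eval_compose, eval_ret (probExcMonad_isContinuous E),
    (probExcMonad_isKleisliTriple E).unit_bind]

/-- Composing with `V` commutes with the choices, leaves the exception alone and raises the power by
one, so the equation for `W` propagates to all iterates. -/
theorem eval_iterW (V : Val (probExcSig E) 0) (e : E) (j : ℕ) :
    eval (probExcMonad E) (iterW V e j) =
      fairMix
        (fairMix ((probExcMonad E).unit (powLeft V j)) (raised e))
        (eval (probExcMonad E) (iterW V e (j + 1))) := by
  have hK := probExcMonad_isKleisliTriple E
  induction j with
  | zero =>
    rw [iterW, eval_progW, eval_fair, eval_fair, eval_raise,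
      eval_ret (probExcMonad_isContinuous E)]
    rfl
  | succ j ih =>
    conv_lhs => rw [iterW, eval_compose_ret, ih]
    rw [fairMix_bind, fairMix_bind, hK.unit_bind, raised_bind,
      ← eval_compose_ret]
    rfl

theorem eval_progT_num (V : Val (probExcSig E) 0) (e : E) (k : ℕ) :
    eval (probExcMonad E) (progT V e (num k)) =
      fairMix
        (fairMix ((probExcMonad E).unit (powRight V k)) (raised e))
        (eval (probExcMonad E) (progT V e (num (k + 1)))) := by
  rw [eval_progT, eval_fair, eval_fair, eval_raise, eval_progR_num]

/-- The function on closed values denoted by a closed value. -/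
noncomputable def applyVal (V U : Val (probExcSig E) 0) : (probExcMonad E).obj (Val (probExcSig E) 0) :=
  eval (probExcMonad E) (.app V U)

theorem map_applyVal_progW (V : Val (probExcSig E) 0) (e : E) :
    (probExcMonad E).map applyVal (eval (probExcMonad E) (progW V e)) =
      (probExcMonad E).map applyVal (eval (probExcMonad E) (progZ V e)) := by
  have hK := probExcMonad_isKleisliTriple E
  refine Subdist.eq_of_mix_oneHalf
    (a := fun j => (probExcMonad E).map applyVal (eval (probExcMonad E) (iterW V e j)))
    -- The numeral `j + 1` matches the shift between the two kinds of power, and `j = 0` gives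
    -- `progZ`.
    (b := fun j =>
      (probExcMonad E).map applyVal (eval (probExcMonad E) (progT V e (num (j + 1)))))
    (c := fun j => fairMix
      ((probExcMonad E).unit (applyVal (powLeft V j))) (raised e))
    (fun j => ?_) (fun j => ?_) 0
  · dsimp only [EffectMonad.map]
    rw [eval_iterW, fairMix_bind, fairMix_bind, hK.unit_bind,
      raised_bind]
    rfl
  · have h : (applyVal (powLeft V j)) = applyVal (powRight V (j + 1)) :=
      funext fun U => eval_app_powLeft V j U
    dsimp only [EffectMonad.map]
    rw [eval_progT_num, fairMix_bind, fairMix_bind, hK.unit_bind,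
      raised_bind, h]
    rfl

/-- Closed programs whose evaluations agree up to the applicative behaviour of values are
bisimilar. -/
theorem bisimilarity_of_map_applyVal {M N : Tm (probExcSig E) 0}
    (h : (probExcMonad E).map applyVal (eval (probExcMonad E) M) =
      (probExcMonad E).map applyVal (eval (probExcMonad E) N)) :
    (bisimilarity (probExcMonad E) (probExcRelator E)).tm M N := by
  have hG := (probExcRelator_isMonadRelator E).isRelator
  -- The kernel of `applyVal`: values related by it have equal evaluations on every argument, so the
  -- clause for values follows from reflexivity of the relator.
  let R : Val (probExcSig E) 0 → Val (probExcSig E) 0 → Prop := fun V W => applyVal V = applyVal W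
  refine ⟨⟨fun M N => (probExcRelator E).inter (probExcRelator E).conv R
    (eval (probExcMonad E) M) (eval (probExcMonad E) N), R⟩, ⟨fun _ _ h => h, ?_⟩, ?_, ?_⟩
  · intro V W hVW U
    have hU : eval (probExcMonad E) (.app V U) = eval (probExcMonad E) (.app W U) :=
      congrFun hVW U
    change _ ∧ _
    rw [hU]
    exact ⟨hG.refl (R := R) (fun _ => rfl) _, hG.refl (R := fun V W => R W V) (fun _ => rfl) _⟩
  · exact (hG.preimage applyVal applyVal (fun f g => f = g) _ _).2 (hG.eq_sub _ _ h)
  · exact (hG.preimage applyVal applyVal (fun f g => g = f) _ _).2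
      (h ▸ hG.refl (R := fun f g => g = f) (fun _ => rfl) _)

theorem bisimilarity_progW_progZ (V : Val (probExcSig E) 0) (e : E) :
    (bisimilarity (probExcMonad E) (probExcRelator E)).tm (progW V e) (progZ V e) :=
  bisimilarity_of_map_applyVal (map_applyVal_progW V e)

end Bisimilar

end EffCalc

theorem mainTheorem4 (E : Type u) :
    IsKleisliTriple (probExcMonad E) ∧
    IsContinuous (probExcMonad E) ∧
    IsMonadRelator (probExcMonad E) (probExcRelator E) ∧
    IsInductive (probExcMonad E) (probExcRelator E) ∧
    RespectsOps (probExcMonad E) (probExcRelator E) ∧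
    (∀ M : Tm (probExcSig E) 0,
      Monotone (fun n => approx (probExcMonad E) n M) ∧
      IsLUB (Set.range fun n => approx (probExcMonad E) n M) (eval (probExcMonad E) M)) ∧
    (similarity (probExcMonad E) (probExcRelator E)).openExt.IsPrecongruence ∧
    (similarity (probExcMonad E) (probExcRelator E)).openExt.Sub
      (ctxPreorder (probExcMonad E) (probExcRelator E)) ∧
    (twoWaySimilarity (probExcMonad E) (probExcRelator E)).openExt.IsCongruence ∧
    (twoWaySimilarity (probExcMonad E) (probExcRelator E)).openExt.Sub
      (ctxEquiv (probExcMonad E) (probExcRelator E)) ∧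
    (bisimilarity (probExcMonad E) (probExcRelator E)).openExt.Sub
      (ctxEquiv (probExcMonad E) (probExcRelator E)) ∧
    (∀ (V : Val (probExcSig E) 0) (e : E),
      eval (probExcMonad E) (progW V e) =
        eval (probExcMonad E)
          (fair (fair (.ret V) (raise e)) (compose (.ret V) (progW V e))) ∧
      (∀ k : ℕ, eval (probExcMonad E) (progT V e (num k)) =
        eval (probExcMonad E)
          (fair (fair (progR V (num k)) (raise e)) (progT V e (num (k + 1))))) ∧
      eval (probExcMonad E) (progR V (num 0)) = eval (probExcMonad E) (.ret identity) ∧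
      (∀ k : ℕ, eval (probExcMonad E) (progR V (num (k + 1))) =
        eval (probExcMonad E) (compose (progR V (num k)) (.ret V))) ∧
      (bisimilarity (probExcMonad E) (probExcRelator E)).tm (progW V e) (progZ V e) ∧
      (ctxEquiv (probExcMonad E) (probExcRelator E)).tm 0 (progW V e) (progZ V e)) := by
  have hT := probExcMonad_isContinuous E
  have hG := probExcRelator_isMonadRelator E
  have hI := probExcRelator_isInductive E
  have hO : RespectsOps (probExcMonad E) (probExcRelator E) := probExcRelator_respectsOps E
  have hP := similarity_isPrecongruence hT hG hI hO
  have hB := bisimilarity_sub_ctxEquiv hT hG hI hO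
  refine ⟨probExcMonad_isKleisliTriple E, hT, hG, hI, hO,
    fun M => ⟨approx_monotone hT M, isLUB_eval hT M⟩, hP,
    hP.compatible.sub_ctxPreorder (similarity_isPreadequate hG.isRelator),
    twoWaySimilarity_isCongruence hT hG hI hO, twoWaySimilarity_sub_ctxEquiv hT hG hI hO, hB,
    fun V e => ⟨eval_progW V e, eval_progT V e, eval_progR_zero V, eval_progR_succ V,
      bisimilarity_progW_progZ V e, ?_⟩⟩
  exact hB.1 0 _ _ ((ClosedRel.openExt_tm_zero _).2 (bisimilarity_progW_progZ V e))
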